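/- Let $p$ be a prime, let $\mathcal F$ be a saturated fusion system on a finite $p$-group $S$, and let $E$ be an $\mathcal F$-essential subgroup of $S$ which is not contained in any other $\mathcal F$-essential subgroup. (Here $P<S$ is *$\mathcal F$-essential* if $P$ is $\mathcal F$-centric and fully $\mathcal F$-normalized and $\operatorname{Out}_{\mathcal F}(P)=\operatorname{Aut}_{\mathcal F}(P)/\operatorname{Inn}(P)$ has a strongly $p$-embedded subgroup; $\mathcal F$ is *saturated* if every subgroup of $S$ is $\mathcal F$-conjugate to one which is fully $\mathcal F$-automized and $\mathcal F$-receptive.) Let $A=N_{\operatorname{Aut}_{\mathcal F}(S)}(E)$ be the group of all $\alpha\in\operatorname{Aut}_{\mathcal F}(S)$ which leave $E$ invariant, and let $C$ be a complement to $N_{\operatorname{Inn}(S)}(E)$ in $A$. Define $S_1=N_S(E)$ and $S_i=N_S(S_{i-1})$ for $i>1$. Assume that no proper subgroup $P$ of $E$ is $S_1$-centric, that is, satisfies $C_{S_1}(P)=Z(P)$. Then, for each $i\ge 1$, $C$ leaves $S_i$ invariant, and, denoting by $C_i\le\operatorname{Aut}(S_i)$ the group of automorphisms induced by $C$ on $S_i$,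 the fusion system $$\mathcal F_i=\langle \operatorname{Inn}(S_i)C_i,\ \operatorname{Aut}_{\mathcal F}(E)\rangle$$ on $S_i$ (the smallest fusion system on $S_i$ whose morphisms include all elements of $\operatorname{Inn}(S_i)C_i$ and of $\operatorname{Aut}_{\mathcal F}(E)$) is saturated. -/

import Mathlib

/-- A fusion system on a subgroup `S` of an ambient group `G`. The ambient group only serves to
house the objects (the subgroups `P ≤ S`), so that fusion systems on `S` and on subgroups of `S`
can be compared. `Hom P Q` is empty unless `P ≤ S` and `Q ≤ S`. -/
@[ext]
structure FusionSystem {G : Type*} [Group G] (S : Subgroup G) where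
  /-- the morphisms from `P` to `Q` -/
  Hom : (P Q : Subgroup G) → Set (P →* Q)
  dom_le : ∀ {P Q : Subgroup G} {φ : P →* Q}, φ ∈ Hom P Q → P ≤ S
  cod_le : ∀ {P Q : Subgroup G} {φ : P →* Q}, φ ∈ Hom P Q → Q ≤ S
  injective : ∀ {P Q : Subgroup G} {φ : P →* Q}, φ ∈ Hom P Q → Function.Injective φ
  /-- conjugation maps by elements of `S` are morphisms (this includes identities and inclusions) -/
  conj_mem : ∀ {P Q : Subgroup G} (φ : P →* Q), P ≤ S → Q ≤ S →
    (∃ g ∈ S, ∀ x : P, (φ x : G) = g * x * g⁻¹) → φ ∈ Hom P Q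
  comp_mem : ∀ {P Q R : Subgroup G} {ψ : Q →* R} {φ : P →* Q},
    ψ ∈ Hom Q R → φ ∈ Hom P Q → ψ.comp φ ∈ Hom P R
  /-- every morphism is an isomorphism in the fusion system followed by an inclusion -/
  factor : ∀ {P Q : Subgroup G} {φ : P →* Q}, φ ∈ Hom P Q →
    ∃ (R : Subgroup G) (hR : R ≤ Q) (e : P ≃* R), e.toMonoidHom ∈ Hom P R ∧
      e.symm.toMonoidHom ∈ Hom R P ∧ φ = (Subgroup.inclusion hR).comp e.toMonoidHom

section GroupNotions

variable {G : Type*} [Group G]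

/-- `N_S(P)` -/
def normalizerIn (S P : Subgroup G) : Subgroup G := S ⊓ Subgroup.normalizer (P : Set G)

/-- `C_S(P)` -/
def centralizerIn (S P : Subgroup G) : Subgroup G := S ⊓ Subgroup.centralizer (P : Set G)

/-- `P` is `S`-centric: `C_S(P) = Z(P)`, where `Z(P) = C_P(P)`. -/
def IsCentricIn (S P : Subgroup G) : Prop := centralizerIn S P = centralizerIn P P

/-- `Aut_S(P)`: the automorphisms of `P` induced by conjugation by elements of `S`. -/
def autConj (S P : Subgroup G) : Subgroup (MulAut P) where
  carrier := {α | ∃ g ∈ S, ∀ x : P, (α x : G) = g * x * g⁻¹}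
  one_mem' := ⟨1, S.one_mem, by simp⟩
  mul_mem' := by
    rintro α β ⟨g, hg, hα⟩ ⟨h, hh, hβ⟩
    exact ⟨g * h, S.mul_mem hg hh, fun x => by
      rw [MulAut.mul_apply, hα, hβ]; group⟩
  inv_mem' := by
    rintro α ⟨g, hg, hα⟩
    refine ⟨g⁻¹, S.inv_mem hg, fun x => ?_⟩
    have h := hα (α⁻¹ x)
    rw [MulAut.apply_inv_self] at h
    rw [h]; group

/-- `Inn(P)` -/
def innerAut (P : Subgroup G) : Subgroup (MulAut P) := (MulAut.conj : P →* MulAut P).range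

instance innerAut_normal (P : Subgroup G) : (innerAut P).Normal where
  conj_mem := by
    rintro _ ⟨g, rfl⟩ α
    refine ⟨α g, ?_⟩
    ext x
    simp [MulAut.conj_apply]

/-- The automorphisms `α` of `S` with `α(E) = E`, for `E ≤ S`. -/
def autStabilizer (S E : Subgroup G) : Subgroup (MulAut S) where
  carrier := {α | ∀ x : S, (α x : G) ∈ E ↔ (x : G) ∈ E}
  one_mem' := by simp
  mul_mem' := by
    intro α β hα hβ x
    rw [MulAut.mul_apply, hα, hβ]
  inv_mem' := by
    intro α hα x
    have h := hα (α⁻¹ x)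
    rw [MulAut.apply_inv_self] at h
    exact h.symm

/-- For `C ≤ Aut(S)` and `T ≤ S`, the group of automorphisms of `T` which are restrictions of
elements of `C`. -/
def inducedAut {S T : Subgroup G} (hT : T ≤ S) (C : Subgroup (MulAut S)) :
    Subgroup (MulAut T) where
  carrier := {β | ∃ α ∈ C, ∀ x : T, (α (Subgroup.inclusion hT x) : G) = β x}
  one_mem' := ⟨1, C.one_mem, by simp⟩
  mul_mem' := by
    rintro β₁ β₂ ⟨α₁, h₁, e₁⟩ ⟨α₂, h₂, e₂⟩
    refine ⟨α₁ * α₂, C.mul_mem h₁ h₂, fun x => ?_⟩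
    have h : α₂ (Subgroup.inclusion hT x) = Subgroup.inclusion hT (β₂ x) :=
      Subtype.ext (e₂ x)
    rw [MulAut.mul_apply, MulAut.mul_apply, h, e₁]
  inv_mem' := by
    rintro β ⟨α, h, e⟩
    refine ⟨α⁻¹, C.inv_mem h, fun x => ?_⟩
    have h : α (Subgroup.inclusion hT (β⁻¹ x)) = Subgroup.inclusion hT x :=
      Subtype.ext (by rw [e, MulAut.apply_inv_self]; rfl)
    rw [← h, MulAut.inv_apply_self]
    rfl

/-- `M` is strongly `p`-embedded in the finite group `H`. -/
def IsStronglyEmbedded {H : Type*} [Group H] (p : ℕ) (M : Subgroup H) : Prop :=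
  M ≠ ⊤ ∧ p ∣ Nat.card M ∧
    ∀ g : H, g ∉ M → ¬ p ∣ Nat.card (M ⊓ M.map (MulAut.conj g).toMonoidHom : Subgroup H)

/-- `S₀ = E` and `S_{i+1} = N_S(S_i)`; in particular `S₁ = N_S(E)`. -/
def normalizerTower (S E : Subgroup G) : ℕ → Subgroup G
  | 0 => E
  | i + 1 => normalizerIn S (normalizerTower S E i)

lemma normalizerTower_le {S E : Subgroup G} (hE : E ≤ S) : ∀ i, normalizerTower S E i ≤ S
  | 0 => hE
  | _ + 1 => inf_le_left

/-- For an isomorphism `α : P → Q`, the subgroup `N_α` of those `g ∈ N_S(P)` for which the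
transport along `α` of conjugation by `g` on `P` belongs to `Aut_S(Q)`. -/
def extensionControl (S : Subgroup G) {P Q : Subgroup G} (α : P ≃* Q) : Subgroup G where
  carrier := {g | g ∈ S ∧ ∃ hg : g ∈ Subgroup.normalizer (P : Set G),
    MulAut.congr α (P.normalizerMonoidHom ⟨g, hg⟩) ∈ autConj S Q}
  one_mem' := ⟨S.one_mem, Subgroup.one_mem _, by
    have : (⟨1, Subgroup.one_mem _⟩ : Subgroup.normalizer (P : Set G)) = 1 := rfl
    rw [this, map_one, map_one]; exact Subgroup.one_mem _⟩
  mul_mem' := by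
    rintro a b ⟨ha, ha', ha''⟩ ⟨hb, hb', hb''⟩
    refine ⟨S.mul_mem ha hb, Subgroup.mul_mem _ ha' hb', ?_⟩
    have : (⟨a * b, Subgroup.mul_mem _ ha' hb'⟩ : Subgroup.normalizer (P : Set G))
      = ⟨a, ha'⟩ * ⟨b, hb'⟩ := rfl
    rw [this, map_mul, map_mul]; exact Subgroup.mul_mem _ ha'' hb''
  inv_mem' := by
    rintro a ⟨ha, ha', ha''⟩
    refine ⟨S.inv_mem ha, Subgroup.inv_mem _ ha', ?_⟩
    have : (⟨a⁻¹, Subgroup.inv_mem _ ha'⟩ : Subgroup.normalizer (P : Set G))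
      = ⟨a, ha'⟩⁻¹ := rfl
    rw [this, map_inv, map_inv]; exact Subgroup.inv_mem _ ha''

lemma le_extensionControl {S P Q : Subgroup G} (hP : P ≤ S) (hQ : Q ≤ S) (α : P ≃* Q) :
    P ≤ extensionControl S α := by
  intro g hg
  refine ⟨hP hg, Subgroup.le_normalizer hg, (α ⟨g, hg⟩ : G), hQ (α ⟨g, hg⟩).2, fun x => ?_⟩
  obtain ⟨y, rfl⟩ := α.surjective x
  have h : P.normalizerMonoidHom ⟨g, Subgroup.le_normalizer hg⟩ y
      = ⟨g, hg⟩ * y * ⟨g, hg⟩⁻¹ := rfl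
  simp [MulAut.congr, h]

/-- The automorphisms in `A`, regarded as homomorphisms between subgroups of `G`. -/
def autMorphisms {P : Subgroup G} (A : Subgroup (MulAut P)) :
    Set (Σ P : Subgroup G, Σ Q : Subgroup G, P →* Q) :=
  {m | ∃ α ∈ A, m = ⟨P, P, α.toMonoidHom⟩}

end GroupNotions

namespace FusionSystem

variable {G : Type*} [Group G] {S : Subgroup G}

/-- The morphism set of `F` contains `X`. -/
def Contains (F : FusionSystem S) (X : Set (Σ P : Subgroup G, Σ Q : Subgroup G, P →* Q)) : Prop :=
  ∀ m ∈ X, m.2.2 ∈ F.Hom m.1 m.2.1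

lemma iso_mem_of_comp_mem (F : FusionSystem S) {P Q R : Subgroup G} (hR : R ≤ Q) (e : P ≃* R)
    (h : (Subgroup.inclusion hR).comp e.toMonoidHom ∈ F.Hom P Q) :
    e.toMonoidHom ∈ F.Hom P R ∧ e.symm.toMonoidHom ∈ F.Hom R P := by
  obtain ⟨R', hR', e', h₁, h₂, h₃⟩ := F.factor h
  have key : ∀ x : P, (e x : G) = e' x := fun x => congrArg Subtype.val (DFunLike.congr_fun h₃ x)
  have hRR : R = R' := by
    ext g
    constructor
    · intro hg
      have := key (e.symm ⟨g, hg⟩)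
      rw [MulEquiv.apply_symm_apply] at this
      change g = _ at this
      rw [this]; exact (e' _).2
    · intro hg
      have := key (e'.symm ⟨g, hg⟩)
      rw [MulEquiv.apply_symm_apply] at this
      change _ = g at this
      rw [← this]; exact (e _).2
  subst hRR
  obtain rfl : e = e' := MulEquiv.ext fun x => Subtype.ext (key x)
  exact ⟨h₁, h₂⟩

/-- The fusion system on `S` generated by a set `X` of monomorphisms between subgroups of `S`:
the intersection of all fusion systems on `S` whose morphism set contains `X`. -/
def generate (S : Subgroup G) (X : Set (Σ P : Subgroup G, Σ Q : Subgroup G, P →* Q)) :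
    FusionSystem S where
  Hom P Q := {φ | P ≤ S ∧ Q ≤ S ∧ Function.Injective φ ∧
    ∀ F : FusionSystem S, F.Contains X → φ ∈ F.Hom P Q}
  dom_le h := h.1
  cod_le h := h.2.1
  injective h := h.2.2.1
  conj_mem := by
    rintro P Q φ hP hQ ⟨g, hg, h⟩
    refine ⟨hP, hQ, fun x y hxy => ?_, fun F _ => F.conj_mem φ hP hQ ⟨g, hg, h⟩⟩
    have := congrArg Subtype.val hxy
    rw [h, h] at this
    exact Subtype.ext (by simpa using this)
  comp_mem := by
    rintro P Q R ψ φ ⟨_, hR, iψ, hψ⟩ ⟨hP, _, iφ, hφ⟩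
    exact ⟨hP, hR, iψ.comp iφ, fun F hF => F.comp_mem (hψ F hF) (hφ F hF)⟩
  factor := by
    rintro P Q φ ⟨hP, hQ, iφ, hφ⟩
    have hR : φ.range.map Q.subtype ≤ Q := by
      rintro _ ⟨y, _, rfl⟩
      exact y.2
    let e : P ≃* (φ.range.map Q.subtype : Subgroup G) :=
      (MonoidHom.ofInjective iφ).trans
        (φ.range.equivMapOfInjective Q.subtype Q.subtype_injective)
    have he : φ = (Subgroup.inclusion hR).comp e.toMonoidHom := by
      ext x
      rfl
    refine ⟨_, hR, e, ⟨hP, hR.trans hQ, e.injective, fun F hF => ?_⟩,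
      ⟨hR.trans hQ, hP, e.symm.injective, fun F hF => ?_⟩, he⟩
    · exact (F.iso_mem_of_comp_mem hR e (he ▸ hφ F hF)).1
    · exact (F.iso_mem_of_comp_mem hR e (he ▸ hφ F hF)).2

variable (F : FusionSystem S)

/-- `Q` belongs to the `F`-conjugacy class of `P`. -/
def IsConjugate (P Q : Subgroup G) : Prop := ∃ α : P ≃* Q, α.toMonoidHom ∈ F.Hom P Q

/-- `Aut_F(P)` -/
def autF {P : Subgroup G} (hP : P ≤ S) : Subgroup (MulAut P) where
  carrier := {α | α.toMonoidHom ∈ F.Hom P P}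
  one_mem' := F.conj_mem _ hP hP ⟨1, S.one_mem, fun x => by simp⟩
  mul_mem' := fun hα hβ => F.comp_mem hα hβ
  inv_mem' := by
    intro α hα
    exact (F.iso_mem_of_comp_mem le_rfl α hα).2

/-- `Out_F(P) = Aut_F(P) / Inn(P)` -/
abbrev outF {P : Subgroup G} (hP : P ≤ S) : Type _ :=
  F.autF hP ⧸ (innerAut P).subgroupOf (F.autF hP)

/-- `P` is fully `F`-normalized. -/
def IsFullyNormalized (P : Subgroup G) : Prop :=
  ∀ Q, F.IsConjugate P Q → Nat.card (normalizerIn S Q) ≤ Nat.card (normalizerIn S P)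

/-- `P` is fully `F`-automized: `Aut_S(P)` is a Sylow `p`-subgroup of `Aut_F(P)`. -/
def IsFullyAutomized (p : ℕ) {P : Subgroup G} (hP : P ≤ S) : Prop :=
  ∃ T : Sylow p (F.autF hP), (T : Subgroup (F.autF hP)) = (autConj S P).subgroupOf (F.autF hP)

/-- `P` is `F`-centric. -/
def IsCentric (P : Subgroup G) : Prop := ∀ Q, F.IsConjugate P Q → IsCentricIn S Q

/-- `P` is `F`-essential. -/
def IsEssential (p : ℕ) (P : Subgroup G) : Prop :=
  ∃ hP : P < S, F.IsCentric P ∧ F.IsFullyNormalized P ∧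
    ∃ M : Subgroup (F.outF hP.le), IsStronglyEmbedded p M

/-- `Q` is `F`-receptive: each isomorphism `α : P → Q` in `F` extends to a morphism
`N_α → S` in `F`. -/
def IsReceptive {Q : Subgroup G} (hQ : Q ≤ S) : Prop :=
  ∀ (P : Subgroup G) (hP : P ≤ S) (α : P ≃* Q), α.toMonoidHom ∈ F.Hom P Q →
    ∃ β ∈ F.Hom (extensionControl S α) S,
      ∀ x : P, (β (Subgroup.inclusion (le_extensionControl hP hQ α) x) : G) = α x

/-- `F` is saturated: each subgroup of `S` is `F`-conjugate to a subgroup which is fully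
`F`-automized and `F`-receptive. -/
def IsSaturated (p : ℕ) : Prop :=
  ∀ P : Subgroup G, P ≤ S → ∃ (Q : Subgroup G) (hQ : Q ≤ S),
    F.IsConjugate P Q ∧ F.IsFullyAutomized p hQ ∧ F.IsReceptive hQ

end FusionSystem

/-! Write `T` for `S_i`, `K` for `Inn(T) C_i` and `D` for `Aut_F(E)`. The proof combines a fact
about `F` above `E` with a saturation criterion for the system generated by `K` and `D`.

Above `E`: each morphism of `F` defined on a subgroup properly containing `E` extends to an
automorphism of `S` in `F` (`FusionSystem.exists_extension_of_lt`). This goes by downward induction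
on the subgroup. If some automorphism of `R > E` did not extend, those which do would give a
strongly `p`-embedded subgroup of `Out_F(R)` (`FusionSystem.exists_isStronglyEmbedded`), so `R`
would be essential, against the maximality of `E`. Consequently `E` is itself fully automized and
receptive. Moreover, an element of `D` conjugating a noninner element of `Aut_T(E)` into `Aut_T(E)`
extends beyond `E`, hence to `S`, hence comes from `A = N_{Inn(S)}(E) C`; as `N_S(E) ≤ T`, it is
induced by `K`.

The criterion is `isSaturated_pairSystem`; morphisms of the generated system are composites of
restrictions of elements of `K` and `D`. If `P ≤ T` is not `K`-conjugate into `E`, only `K` acts on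
it, and `Inn(T)` is a normal Sylow `p`-subgroup of `K`. If `P` is `K`-conjugate to `E`, the
properties of `D` above apply. Otherwise `P` is `K`-conjugate to a proper subgroup of `E`; then no
conjugate of `P` contains its centralizer in `T`, and each isomorphism in the class is a composite
of isomorphisms that extend to larger subgroups.

The last case is an instance of the principle that saturation need only be tested on centric
subgroups (`FusionSystem.saturatedAt_of_not_centric`). One finds a conjugate `Q` which receives the
normalizers of all conjugates, extends the automorphisms of `Q` to `Q C_T(Q) > Q`, and transfers the
Sylow and extension properties of that larger group to `Q`. -/

section GroupLemmas

/-! ### Sylow arguments and normalizer growth in finite groups. -/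

variable {M : Type*} [Group M]

theorem relIndex_map_dvd {M' : Type*} [Group M'] (φ : M →* M') {A B : Subgroup M} :
    (A.map φ).relIndex (B.map φ) ∣ A.relIndex B := by
  rw [Subgroup.relIndex_map_map]
  have h1 : (A ⊔ φ.ker).relIndex (B ⊔ φ.ker) = (A ⊔ φ.ker).relIndex B := by
    have h2 : φ.ker ≤ A ⊔ φ.ker := le_sup_right
    have h3 : ((A ⊔ φ.ker).map φ).relIndex (B.map φ) =
      ((A ⊔ φ.ker).map φ).relIndex ((B ⊔ φ.ker).map φ) := by
      rw [Subgroup.map_sup, Subgroup.map_sup, (Subgroup.map_eq_bot_iff _).2 le_rfl]; simp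
    have h4 : ((A ⊔ φ.ker).map φ).comap φ = A ⊔ φ.ker := Subgroup.comap_map_eq_self h2
    rw [← h4, Subgroup.relIndex_comap, Subgroup.relIndex_comap, h3]
  rw [h1]
  exact Subgroup.relIndex_dvd_of_le_left _ le_sup_left

/-- A version of Sylow's conjugation theorem inside `N * P`, where `N` is normal in `H` and `P` has
index prime to `p` in `H`. -/
theorem exists_conj_le_of_le_mul [Finite M] {p : ℕ} [Fact p.Prime] {H N P Y : Subgroup M}
    (hPH : P ≤ H) (hP : IsPGroup p P) (hi : ¬ p ∣ P.relIndex H) (hNH : N ≤ H)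
    (hN : ∀ h ∈ H, ∀ n ∈ N, h * n * h⁻¹ ∈ N) (hY : IsPGroup p Y)
    (hYN : ∀ y ∈ Y, ∃ n ∈ N, n * y ∈ P) :
    ∃ n ∈ N, ∀ y ∈ Y, n * y * n⁻¹ ∈ P := by
  -- `D` is the product `N P`. It contains `Y`, and `P` is Sylow in it, so some element of `N P`
  -- conjugates `Y` into `P`; its factor in `P` can be dropped.
  let D : Subgroup M :=
    { carrier := {d | ∃ n ∈ N, n * d ∈ P}
      one_mem' := ⟨1, N.one_mem, by simp⟩
      mul_mem' := by
        rintro a b ⟨m, hm, hma⟩ ⟨n, hn, hnb⟩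
        have ha : m * a ∈ H := hPH hma
        refine ⟨(m * a) * n * (m * a)⁻¹ * m, N.mul_mem (hN _ ha _ hn) hm, ?_⟩
        have : m * a * n * (m * a)⁻¹ * m * (a * b) = (m * a) * (n * b) := by group
        rw [this]; exact P.mul_mem hma hnb
      inv_mem' := by
        rintro a ⟨m, hm, hma⟩
        have ha : m * a ∈ H := hPH hma
        refine ⟨(m * a)⁻¹ * m⁻¹ * ((m * a)⁻¹)⁻¹, hN _ (H.inv_mem ha) _ (N.inv_mem hm), ?_⟩
        have : (m * a)⁻¹ * m⁻¹ * ((m * a)⁻¹)⁻¹ * a⁻¹ = (m * a)⁻¹ := by group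
        rw [this]; exact P.inv_mem hma }
  have hDH : D ≤ H := by
    rintro d ⟨n, hn, hd⟩
    have := H.mul_mem (H.inv_mem (hNH hn)) (hPH hd)
    rwa [inv_mul_cancel_left] at this
  have hPD : P ≤ D := fun x hx => ⟨1, N.one_mem, by simpa using hx⟩
  have hYD : Y ≤ D := fun y hy => hYN y hy
  have hiD : ¬ p ∣ (P.subgroupOf D).index := fun h =>
    hi (h.trans ⟨_, (Subgroup.relIndex_mul_relIndex P D H hPD hDH).symm⟩)
  have hPpD : IsPGroup p (P.subgroupOf D) := hP.comap_subtype
  obtain ⟨Q, hQ⟩ := (hY.comap_subtype (K := D)).exists_le_sylow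
  obtain ⟨d, hd⟩ := MulAction.exists_smul_eq D Q (hPpD.toSylow hiD)
  obtain ⟨n, hn, hnd⟩ := (d⁻¹).2
  refine ⟨n, hn, fun y hy => ?_⟩
  have hyQ : (⟨y, hYD hy⟩ : D) ∈ Q := hQ (Subgroup.mem_subgroupOf.2 hy)
  have h1 : MulAut.conj d • (⟨y, hYD hy⟩ : D) ∈ (d • Q : Sylow p D) :=
    Subgroup.smul_mem_pointwise_smul _ (MulAut.conj d) (Q : Subgroup D) hyQ
  rw [hd] at h1
  have h2 : (d : M) * y * (d : M)⁻¹ ∈ P := by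
    simpa [Subgroup.mem_subgroupOf] using h1
  have h3 := P.mul_mem (P.mul_mem hnd h2) (P.inv_mem hnd)
  have h4 : n * ((d⁻¹ : D) : M) * ((d : M) * y * (d : M)⁻¹) * (n * ((d⁻¹ : D) : M))⁻¹
      = n * y * n⁻¹ := by
    push_cast; group
  rwa [h4] at h3

/-- A subgroup `P` of index prime to `p` in `H` meets a suitable `H`-conjugate of each subgroup
`H₁` of `H` in a subgroup of index prime to `p`. -/
theorem exists_conj_inf_relIndex [Finite M] {p : ℕ} [Fact p.Prime] {H H₁ P : Subgroup M}
    (hPH : P ≤ H) (hP : IsPGroup p P) (hi : ¬ p ∣ P.relIndex H) (hH₁ : H₁ ≤ H) :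
    ∃ h ∈ H, ¬ p ∣ P.relIndex (H₁.map (MulAut.conj h).toMonoidHom) := by
  obtain ⟨Y⟩ : Nonempty (Sylow p H₁) := inferInstance
  have hYp : IsPGroup p ((Y : Subgroup H₁).map H₁.subtype) := Y.2.map _
  obtain ⟨h, hh, hc⟩ := exists_conj_le_of_le_mul (H := H) (N := H) hPH hP hi le_rfl
    (fun a ha b hb => H.mul_mem (H.mul_mem ha hb) (H.inv_mem ha)) hYp (by
      rintro _ ⟨y, _, rfl⟩
      exact ⟨(y : M)⁻¹, H.inv_mem (hH₁ y.2), by simp⟩)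
  refine ⟨h, hh, fun hd => Y.not_dvd_index (hd.trans ?_)⟩
  have hle : ((Y : Subgroup H₁).map H₁.subtype).map (MulAut.conj h).toMonoidHom ≤ P := by
    rintro _ ⟨y, hy, rfl⟩
    exact hc y hy
  refine (Subgroup.relIndex_dvd_of_le_left _ hle).trans ?_
  rw [Subgroup.relIndex_map_map_of_injective _ _ (MulAut.conj h).injective]
  rw [Subgroup.relIndex, Subgroup.subgroupOf,
    Subgroup.comap_map_eq_self_of_injective H₁.subtype_injective]

/-- Normalizers grow in finite `p`-groups. -/
theorem exists_mem_normalizer_notMem {p : ℕ} [Fact p.Prime] {P R : Subgroup M} [Finite R]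
    (hR : IsPGroup p R) (h : P < R) :
    ∃ g ∈ R, g ∈ Subgroup.normalizer (P : Set M) ∧ g ∉ P := by
  have : Group.IsNilpotent R := hR.isNilpotent
  have hlt : P.subgroupOf R < ⊤ := by
    rw [lt_top_iff_ne_top, Ne, Subgroup.subgroupOf_eq_top]
    exact h.not_ge
  obtain ⟨g, hg, hgP⟩ := SetLike.exists_of_lt
    (Group.normalizerCondition_of_isNilpotent (G := R) _ hlt)
  refine ⟨g, g.2, ?_, fun hh => hgP (Subgroup.mem_subgroupOf.2 hh)⟩
  rw [Subgroup.mem_normalizer_iff] at hg ⊢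
  intro x
  constructor
  · intro hx
    exact Subgroup.mem_subgroupOf.1 ((hg ⟨x, h.le hx⟩).1 (Subgroup.mem_subgroupOf.2 hx))
  · intro hx
    have hxR : x ∈ R := by
      have := R.mul_mem (R.mul_mem (R.inv_mem g.2) (h.le hx)) g.2
      have e : (g : M)⁻¹ * (g * x * (g : M)⁻¹) * g = x := by group
      rwa [e] at this
    exact Subgroup.mem_subgroupOf.1 ((hg ⟨x, hxR⟩).2 (Subgroup.mem_subgroupOf.2 hx))

end GroupLemmas

/-! ### Morphisms, receptivity and automization in terms of functions on the ambient group. -/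

open Classical in
/-- Extend a function on `P` by the identity to the ambient group. -/
noncomputable def extendFun {G : Type*} [Group G] {P : Subgroup G} (φ : P → G) : G → G :=
  fun x => if h : x ∈ P then φ ⟨x, h⟩ else x

theorem extendFun_apply {G : Type*} [Group G] {P : Subgroup G} (φ : P → G) (x : P) :
    extendFun φ x = φ x := by
  simp [extendFun]

namespace FusionSystem

variable {G : Type*} [Group G] {S : Subgroup G}

/-- The function `f` restricts to an isomorphism `P → Q` in `F`. -/
def IsoOn (F : FusionSystem S) (P Q : Subgroup G) (f : G → G) : Prop :=
  ∃ α : P ≃* Q, α.toMonoidHom ∈ F.Hom P Q ∧ ∀ x : P, (α x : G) = f x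

/-- The function `f` restricts to a morphism in `F` defined on `P`. -/
def MorOn (F : FusionSystem S) (P : Subgroup G) (f : G → G) : Prop := ∃ Q, F.IsoOn P Q f

variable {F : FusionSystem S} {P Q R P' Q' : Subgroup G} {f g : G → G}

theorem isoOn_extendFun {α : P ≃* Q} (h : α.toMonoidHom ∈ F.Hom P Q) :
    F.IsoOn P Q (extendFun fun x => (α x : G)) :=
  ⟨α, h, fun x => (extendFun_apply (fun x => (α x : G)) x).symm⟩

namespace IsoOn

theorem dom_le (h : F.IsoOn P Q f) : P ≤ S := by
  obtain ⟨α, hα, _⟩ := h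
  exact F.dom_le hα

theorem cod_le (h : F.IsoOn P Q f) : Q ≤ S := by
  obtain ⟨α, hα, _⟩ := h
  exact F.cod_le hα

theorem mem (h : F.IsoOn P Q f) {x : G} (hx : x ∈ P) : f x ∈ Q := by
  obtain ⟨α, _, h⟩ := h
  rw [← h ⟨x, hx⟩]
  exact (α _).2

theorem map_mul (h : F.IsoOn P Q f) {x y : G} (hx : x ∈ P) (hy : y ∈ P) :
    f (x * y) = f x * f y := by
  obtain ⟨α, _, h⟩ := h
  have := h (⟨x, hx⟩ * ⟨y, hy⟩)
  rw [_root_.map_mul, Subgroup.coe_mul, h, h] at this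
  exact this.symm

theorem map_one (h : F.IsoOn P Q f) : f 1 = 1 := by
  have := h.map_mul P.one_mem P.one_mem
  simpa using this

theorem map_inv (h : F.IsoOn P Q f) {x : G} (hx : x ∈ P) : f x⁻¹ = (f x)⁻¹ := by
  have := h.map_mul (P.inv_mem hx) hx
  rw [inv_mul_cancel, h.map_one] at this
  exact eq_inv_of_mul_eq_one_left this.symm

theorem map_conj (h : F.IsoOn P Q f) {x y : G} (hx : x ∈ P) (hy : y ∈ P) :
    f (x * y * x⁻¹) = f x * f y * (f x)⁻¹ := by
  rw [h.map_mul (P.mul_mem hx hy) (P.inv_mem hx), h.map_mul hx hy, h.map_inv hx]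

theorem inj (h : F.IsoOn P Q f) {x y : G} (hx : x ∈ P) (hy : y ∈ P) (hxy : f x = f y) :
    x = y := by
  obtain ⟨α, _, h⟩ := h
  have : α ⟨x, hx⟩ = α ⟨y, hy⟩ := Subtype.ext (by rw [h, h]; exact hxy)
  exact congrArg Subtype.val (α.injective this)

theorem surj (h : F.IsoOn P Q f) {y : G} (hy : y ∈ Q) : ∃ x ∈ P, f x = y := by
  obtain ⟨α, _, h⟩ := h
  refine ⟨α.symm ⟨y, hy⟩, (α.symm _).2, ?_⟩
  rw [← h, MulEquiv.apply_symm_apply]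

theorem card_eq (h : F.IsoOn P Q f) : Nat.card P = Nat.card Q := by
  obtain ⟨α, _, _⟩ := h
  exact Nat.card_congr α.toEquiv

theorem congr (h : F.IsoOn P Q f) (hfg : ∀ x ∈ P, g x = f x) : F.IsoOn P Q g := by
  obtain ⟨α, hα, h⟩ := h
  exact ⟨α, hα, fun x => by rw [h, hfg x x.2]⟩

theorem refl (hP : P ≤ S) : F.IsoOn P P id :=
  ⟨MulEquiv.refl P, F.conj_mem _ hP hP ⟨1, S.one_mem, fun x => by simp⟩, fun _ => rfl⟩

theorem comp (hg : F.IsoOn Q R g) (hf : F.IsoOn P Q f) : F.IsoOn P R (g ∘ f) := by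
  obtain ⟨α, hα, ha⟩ := hf
  obtain ⟨β, hβ, hb⟩ := hg
  exact ⟨α.trans β, F.comp_mem hβ hα, fun x => by simp [hb, ha]⟩

theorem symm (h : F.IsoOn P Q f) :
    ∃ g, F.IsoOn Q P g ∧ (∀ x ∈ P, g (f x) = x) ∧ ∀ y ∈ Q, f (g y) = y := by
  obtain ⟨α, hα, ha⟩ := h
  refine ⟨extendFun fun x => (α.symm x : G), isoOn_extendFun
    (F.iso_mem_of_comp_mem le_rfl α hα).2, fun x hx => ?_, fun y hy => ?_⟩
  · rw [← ha ⟨x, hx⟩, extendFun_apply, α.symm_apply_apply]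
  · rw [extendFun_apply (P := Q) _ ⟨y, hy⟩, ← ha, α.apply_symm_apply]

end IsoOn

theorem exists_isoOn_of_mem_hom {φ : P →* Q} (hφ : φ ∈ F.Hom P Q) :
    ∃ R ≤ Q, F.IsoOn P R (extendFun fun x => (φ x : G)) := by
  obtain ⟨R, hR, e, he, _, rfl⟩ := F.factor hφ
  exact ⟨R, hR, e, he, fun x => by rw [extendFun_apply]; rfl⟩

namespace IsoOn

theorem exists_hom (h : F.IsoOn P R f) (hRQ : R ≤ Q) (hQ : Q ≤ S) :
    ∃ φ ∈ F.Hom P Q, ∀ x : P, (φ x : G) = f x := by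
  obtain ⟨α, hα, h⟩ := h
  exact ⟨(Subgroup.inclusion hRQ).comp α.toMonoidHom, F.comp_mem (F.conj_mem _ (F.cod_le hα) hQ
    ⟨1, S.one_mem, fun x => by simp⟩) hα, h⟩

theorem restrict (h : F.IsoOn P Q f) (hP' : P' ≤ P) : ∃ Q' ≤ Q, F.IsoOn P' Q' f := by
  obtain ⟨α, hα, h⟩ := h
  have h1 : Subgroup.inclusion hP' ∈ F.Hom P' P :=
    F.conj_mem _ (hP'.trans (F.dom_le hα)) (F.dom_le hα) ⟨1, S.one_mem, fun x => by simp⟩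
  obtain ⟨R, hR, hi⟩ := exists_isoOn_of_mem_hom (F.comp_mem hα h1)
  refine ⟨R, hR, hi.congr fun x hx => ?_⟩
  rw [extendFun_apply (P := P') _ ⟨x, hx⟩, ← h ⟨x, hP' hx⟩]
  rfl

theorem restrict_of_iff (h : F.IsoOn P Q f) (hP' : P' ≤ P) (hm : ∀ x ∈ P', f x ∈ Q')
    (hs : ∀ y ∈ Q', ∃ x ∈ P', f x = y) : F.IsoOn P' Q' f := by
  obtain ⟨R, _, hi⟩ := h.restrict hP'
  have : R = Q' := by
    ext y
    constructor
    · intro hy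
      obtain ⟨x, hx, rfl⟩ := hi.surj hy
      exact hm x hx
    · intro hy
      obtain ⟨x, hx, rfl⟩ := hs y hy
      exact hi.mem hx
  rwa [← this]

theorem morOn (h : F.IsoOn P Q f) : F.MorOn P f := ⟨Q, h⟩

theorem isConjugate (h : F.IsoOn P Q f) : F.IsConjugate P Q := by
  obtain ⟨α, hα, _⟩ := h
  exact ⟨α, hα⟩

end IsoOn

theorem isConjugate_iff : F.IsConjugate P Q ↔ ∃ f, F.IsoOn P Q f :=
  ⟨fun ⟨_, hα⟩ => ⟨_, isoOn_extendFun hα⟩, fun ⟨_, h⟩ => h.isConjugate⟩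

theorem isoOn_conj (hP : P ≤ S) {t : G} (ht : t ∈ S) :
    F.IsoOn P (P.map (MulAut.conj t).toMonoidHom) (fun x => t * x * t⁻¹) := by
  have hle : P.map (MulAut.conj t).toMonoidHom ≤ S := by
    rintro _ ⟨x, hx, rfl⟩
    exact S.mul_mem (S.mul_mem ht (hP hx)) (S.inv_mem ht)
  exact ⟨P.equivMapOfInjective _ (MulAut.conj t).injective,
    F.conj_mem _ hP hle ⟨t, ht, fun x => rfl⟩, fun x => rfl⟩

theorem MorOn.restrict (h : F.MorOn P f) (hP' : P' ≤ P) : F.MorOn P' f := by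
  obtain ⟨_, h⟩ := h
  obtain ⟨_, _, h'⟩ := h.restrict hP'
  exact ⟨_, h'⟩

theorem mem_autF_iff {hP : P ≤ S} {α : MulAut P} :
    α ∈ F.autF hP ↔ F.IsoOn P P (extendFun fun x => (α x : G)) := by
  refine ⟨fun h => isoOn_extendFun h, fun ⟨β, hβ, h⟩ => ?_⟩
  have : β = α := MulEquiv.ext fun x => Subtype.ext (by rw [h, extendFun_apply])
  rwa [this] at hβ

theorem exists_mem_autF (h : F.IsoOn P P f) :
    ∃ α ∈ F.autF h.dom_le, ∀ x : P, (α x : G) = f x := h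

/-- A reformulation of receptivity in terms of functions on the ambient group. -/
def Receptive (F : FusionSystem S) (Q : Subgroup G) : Prop :=
  ∀ P f, F.IsoOn P Q f → ∃ X f', F.MorOn X f' ∧ (∀ x ∈ P, f' x = f x) ∧
    ∀ g ∈ S, g ∈ Subgroup.normalizer (P : Set G) →
      (∃ t ∈ S, ∀ x ∈ P, f (g * x * g⁻¹) = t * f x * t⁻¹) → g ∈ X

theorem mem_extensionControl_iff {α : P ≃* Q} (hα : ∀ x : P, (α x : G) = f x) {g : G} :
    g ∈ extensionControl S α ↔ g ∈ S ∧ g ∈ Subgroup.normalizer (P : Set G) ∧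
      ∃ t ∈ S, ∀ x ∈ P, f (g * x * g⁻¹) = t * f x * t⁻¹ := by
  constructor
  · rintro ⟨hg, hn, t, ht, h⟩
    refine ⟨hg, hn, t, ht, fun x hx => ?_⟩
    have h1 := h (α ⟨x, hx⟩)
    have h2 : MulAut.congr α (P.normalizerMonoidHom ⟨g, hn⟩) (α ⟨x, hx⟩) =
        α (P.normalizerMonoidHom ⟨g, hn⟩ ⟨x, hx⟩) := by simp [MulAut.congr]
    rw [h2, hα, hα] at h1
    exact h1
  · rintro ⟨hg, hn, t, ht, h⟩
    refine ⟨hg, hn, t, ht, fun y => ?_⟩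
    obtain ⟨x, rfl⟩ := α.surjective y
    have h2 : MulAut.congr α (P.normalizerMonoidHom ⟨g, hn⟩) (α x) =
        α (P.normalizerMonoidHom ⟨g, hn⟩ x) := by simp [MulAut.congr]
    rw [h2, hα, hα]
    exact h x x.2

theorem isReceptive_iff (hQ : Q ≤ S) : F.IsReceptive hQ ↔ F.Receptive Q := by
  constructor
  · rintro h P f hf
    have hP := hf.dom_le
    obtain ⟨α, hα, ha⟩ := hf
    obtain ⟨β, hβ, hb⟩ := h P hP α hα
    obtain ⟨R, hR, hi⟩ := exists_isoOn_of_mem_hom hβ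
    refine ⟨_, _, hi.morOn, fun x hx => ?_, fun g hg hn ht =>
      (mem_extensionControl_iff ha).2 ⟨hg, hn, ht⟩⟩
    exact (extendFun_apply (fun x => (β x : G))
      (Subgroup.inclusion (le_extensionControl hP hQ α) ⟨x, hx⟩)).trans
        ((hb ⟨x, hx⟩).trans (ha ⟨x, hx⟩))
  · rintro h P hP α hα
    obtain ⟨X, f', ⟨Y, hX⟩, hf', hc⟩ := h P _ (isoOn_extendFun hα)
    have hle : extensionControl S α ≤ X := fun g hg => by
      obtain ⟨h1, h2, h3⟩ := (mem_extensionControl_iff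
        (fun x => (extendFun_apply (fun x => (α x : G)) x).symm)).1 hg
      exact hc g h1 h2 h3
    obtain ⟨Z, _, hZ⟩ := hX.restrict hle
    obtain ⟨φ, hφ, he⟩ := hZ.exists_hom hZ.cod_le le_rfl
    refine ⟨φ, hφ, fun x => ?_⟩
    rw [he, ← extendFun_apply (fun x => (α x : G)) x]
    exact hf' x x.2

/-- `Aut_S(P)` has index prime to `p` in `Aut_F(P)`. -/
def Automized (F : FusionSystem S) (p : ℕ) {P : Subgroup G} (hP : P ≤ S) : Prop :=
  ¬ p ∣ (autConj S P).relIndex (F.autF hP)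

theorem autConj_le_autF (hP : P ≤ S) : autConj S P ≤ F.autF hP := fun _ hα =>
  F.conj_mem _ hP hP hα

theorem mem_normalizer_of_conj {α : MulAut P} {g : G} (h : ∀ x : P, (α x : G) = g * x * g⁻¹) :
    g ∈ Subgroup.normalizer (P : Set G) := by
  rw [Subgroup.mem_normalizer_iff]
  intro x
  constructor
  · intro hx
    rw [← h ⟨x, hx⟩]
    exact (α _).2
  · intro hx
    have h1 := h (α⁻¹ ⟨_, hx⟩)
    rw [MulAut.apply_inv_self] at h1
    have h2 : x = (α⁻¹ ⟨_, hx⟩ : P) := by simpa using h1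
    rw [h2]
    exact (α⁻¹ _).2

theorem isPGroup_autConj {p : ℕ} (hS : IsPGroup p S) : IsPGroup p (autConj S P) := by
  have h : (autConj S P) =
      ((S ⊓ Subgroup.normalizer (P : Set G)).subgroupOf (Subgroup.normalizer (P : Set G))).map
        P.normalizerMonoidHom := by
    ext α
    constructor
    · rintro ⟨g, hg, h⟩
      refine ⟨⟨g, mem_normalizer_of_conj h⟩, ⟨hg, mem_normalizer_of_conj h⟩, ?_⟩
      ext x
      rw [h]
      rfl
    · rintro ⟨g, hg, rfl⟩
      exact ⟨g, hg.1, fun x => rfl⟩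
  rw [h]
  exact ((hS.to_le inf_le_left).comap_subtype).map _

theorem isFullyAutomized_iff {p : ℕ} [Fact p.Prime] [Finite S] (hS : IsPGroup p S) (hP : P ≤ S) :
    F.IsFullyAutomized p hP ↔ F.Automized p hP := by
  have : Finite P := Finite.of_injective _ (Subgroup.inclusion_injective hP)
  constructor
  · rintro ⟨T, hT⟩ h
    apply T.not_dvd_index
    rw [hT]
    exact h
  · intro h
    exact ⟨(isPGroup_autConj hS).comap_subtype.toSylow h, rfl⟩

/-- `P` is conjugate in `F` to a fully automized and receptive subgroup. -/
def SaturatedAt (F : FusionSystem S) (p : ℕ) (P : Subgroup G) : Prop :=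
  ∃ (Q : Subgroup G) (hQ : Q ≤ S) (f : G → G), F.IsoOn P Q f ∧ F.Automized p hQ ∧ F.Receptive Q

theorem isSaturated_iff {p : ℕ} [Fact p.Prime] [Finite S] (hS : IsPGroup p S) :
    F.IsSaturated p ↔ ∀ P ≤ S, F.SaturatedAt p P := by
  refine forall₂_congr fun P hP => exists₂_congr fun Q hQ => ?_
  rw [isConjugate_iff, isFullyAutomized_iff hS, isReceptive_iff]
  simp

theorem SaturatedAt.of_isoOn {p : ℕ} (h : F.SaturatedAt p Q) (hf : F.IsoOn P Q f) :
    F.SaturatedAt p P := by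
  obtain ⟨R, hR, g, hg, h⟩ := h
  exact ⟨R, hR, _, hg.comp hf, h⟩

end FusionSystem

/-! ### Good pairs and extension of isomorphisms onto them. -/

/-- The automorphisms of `R` which are the identity on `Q`. -/
def autFixing {G : Type*} [Group G] (R Q : Subgroup G) : Subgroup (MulAut R) where
  carrier := {α | ∀ x : R, (x : G) ∈ Q → α x = x}
  one_mem' := by simp
  mul_mem' := by
    intro α β hα hβ x hx
    rw [MulAut.mul_apply, hβ x hx, hα x hx]
  inv_mem' := by
    intro α hα x hx
    have := congrArg (fun z => α⁻¹ z) (hα x hx)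
    simpa using this.symm

namespace FusionSystem

variable {G : Type*} [Group G] {S : Subgroup G} {F : FusionSystem S} {p : ℕ}
  {R Q R' Q' : Subgroup G} {f : G → G}

/-- The subgroup `R` is receptive, and `Aut_S(R)` contains a Sylow `p`-subgroup of the stabilizer of
`Q` in `Aut_F(R)`. -/
def GoodPair (F : FusionSystem S) (p : ℕ) {R : Subgroup G} (hR : R ≤ S) (Q : Subgroup G) : Prop :=
  Q ≤ R ∧ F.Receptive R ∧ ¬ p ∣ (autConj S R).relIndex (F.autF hR ⊓ autStabilizer R Q)

theorem IsoOn.apply_mem_iff (hf : F.IsoOn R' R f) (hfQ : F.IsoOn Q' Q f) (hQ' : Q' ≤ R') {x : G}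
    (hx : x ∈ R') : f x ∈ Q ↔ x ∈ Q' := by
  refine ⟨fun h => ?_, fun h => hfQ.mem h⟩
  obtain ⟨y, hy, hxy⟩ := hfQ.surj h
  rwa [← hf.inj (hQ' hy) hx hxy]

/-- Start from a fully automized receptive conjugate `R₁` of `R`. An element `h` of `Aut_F(R₁)`
conjugates the stabilizer of the image of `Q` so that `Aut_S(R₁)` meets it in a Sylow subgroup;
replacing that image by its image under `h` gives the pair. -/
theorem exists_goodPair [Fact p.Prime] [Finite S] (hS : IsPGroup p S) (h : F.SaturatedAt p R)
    (hQ : Q ≤ R) : ∃ (R₁ Q₁ : Subgroup G) (hR₁ : R₁ ≤ S) (f : G → G),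
      F.IsoOn R R₁ f ∧ F.IsoOn Q Q₁ f ∧ F.GoodPair p hR₁ Q₁ := by
  obtain ⟨R₁, hR₁, f, hf, ha, hr⟩ := h
  have : Finite R₁ := Finite.of_injective _ (Subgroup.inclusion_injective hR₁)
  obtain ⟨Q₁, hQ₁, hfQ⟩ := hf.restrict hQ
  obtain ⟨h, hh, hi⟩ := exists_conj_inf_relIndex (autConj_le_autF hR₁) (isPGroup_autConj hS) ha
    (inf_le_left : F.autF hR₁ ⊓ autStabilizer R₁ Q₁ ≤ F.autF hR₁)
  have hhi := mem_autF_iff.1 hh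
  obtain ⟨Q₂, hQ₂, hhQ⟩ := hhi.restrict hQ₁
  refine ⟨R₁, Q₂, hR₁, _, hhi.comp hf, hhQ.comp hfQ, hQ₂, hr, ?_⟩
  have hmem : ∀ x : R₁, (h x : G) ∈ Q₂ ↔ (x : G) ∈ Q₁ := fun x => by
    have := hhi.apply_mem_iff hhQ hQ₁ x.2
    rwa [extendFun_apply] at this
  convert hi using 3
  ext ν
  constructor
  · rintro ⟨h1, h2⟩
    refine ⟨h⁻¹ * ν * h, ⟨Subgroup.mul_mem _ (Subgroup.mul_mem _ (Subgroup.inv_mem _ hh) h1) hh,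
      fun x => ?_⟩, ?_⟩
    · rw [← hmem, MulAut.mul_apply, MulAut.mul_apply, MulAut.apply_inv_self, h2, hmem]
    · change h * (h⁻¹ * ν * h) * h⁻¹ = ν
      group
  · rintro ⟨μ, ⟨h1, h2⟩, rfl⟩
    refine ⟨Subgroup.mul_mem _ (Subgroup.mul_mem _ hh h1) (Subgroup.inv_mem _ hh), fun x => ?_⟩
    change ((h * μ * h⁻¹) x : G) ∈ Q₂ ↔ _
    rw [MulAut.mul_apply, MulAut.mul_apply, hmem, h2, ← hmem, MulAut.apply_inv_self]

/-- Transport along `f` turns the action of `Y` on `R'` into a `p`-subgroup of the stabilizer of `Q`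
in `Aut_F(R)`. By Sylow's theorem some `ν ∈ N` conjugates it into `Aut_S(R)`, so that receptivity
extends `ν ∘ f` to `Y`. The choice of `N` decides how far `f` may be altered. -/
theorem GoodPair.exists_extension [Fact p.Prime] [Finite S] (hS : IsPGroup p S) {hR : R ≤ S}
    (hp : F.GoodPair p hR Q) {N : Subgroup (MulAut R)} (hN : N ≤ F.autF hR ⊓ autStabilizer R Q)
    (hNn : ∀ h ∈ F.autF hR ⊓ autStabilizer R Q, ∀ n ∈ N, h * n * h⁻¹ ∈ N)
    (hf : F.IsoOn R' R f) (hfQ : F.IsoOn Q' Q f) (hQ' : Q' ≤ R') {Y : Subgroup G} (hYS : Y ≤ S)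
    (hYR : Y ≤ Subgroup.normalizer (R' : Set G)) (hYQ : Y ≤ Subgroup.normalizer (Q' : Set G))
    (hYN : ∀ y ∈ Y, ∀ β ∈ F.autF hR ⊓ autStabilizer R Q,
      (∀ x : R, ∀ z ∈ R', (x : G) = f z → (β x : G) = f (y * z * y⁻¹)) →
      ∃ ν ∈ N, ν * β ∈ autConj S R) :
    ∃ ν ∈ N, ∃ X f', F.MorOn X f' ∧ R' ≤ X ∧ Y ≤ X ∧
      ∀ x : R, ∀ z ∈ R', (x : G) = f z → f' z = ν x := by
  have : Finite R := Finite.of_injective _ (Subgroup.inclusion_injective hR)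
  obtain ⟨-, hr, hi⟩ := hp
  have hR' := hf.dom_le
  obtain ⟨α, hα, ha⟩ := id hf
  let θ : Y →* MulAut R := (MulAut.congr α).toMonoidHom.comp
    (R'.normalizerMonoidHom.comp (Subgroup.inclusion hYR))
  have hθ : ∀ (y : Y) (x : R'), (θ y (α x) : G) = f (y * x * (y : G)⁻¹) := fun y x => by
    have : θ y (α x) = α (R'.normalizerMonoidHom (Subgroup.inclusion hYR y) x) := by
      simp [θ, MulAut.congr]
    rw [this, ha]
    rfl
  have hθ' : ∀ (y : Y) (x : R), ∀ z ∈ R', (x : G) = f z → (θ y x : G) = f (y * z * (y : G)⁻¹) := by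
    intro y x z hz hx
    have : x = α ⟨z, hz⟩ := Subtype.ext (by rw [ha]; exact hx)
    rw [this, hθ]
  have hθH : ∀ y, θ y ∈ F.autF hR ⊓ autStabilizer R Q := by
    intro y
    constructor
    · have h1 : (R'.normalizerMonoidHom (Subgroup.inclusion hYR y)).toMonoidHom ∈ F.Hom R' R' :=
        F.conj_mem _ hR' hR' ⟨y, hYS y.2, fun x => rfl⟩
      exact F.comp_mem hα (F.comp_mem h1 (F.iso_mem_of_comp_mem le_rfl α hα).2)
    · intro x
      obtain ⟨z, rfl⟩ := α.surjective x
      have hz := Subgroup.mem_normalizer_iff.1 (hYR y.2) z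
      rw [hθ, hf.apply_mem_iff hfQ hQ' (hz.1 z.2), ha, hf.apply_mem_iff hfQ hQ' z.2]
      exact (Subgroup.mem_normalizer_iff.1 (hYQ y.2) z).symm
  have hYp : IsPGroup p θ.range := by
    rw [MonoidHom.range_eq_map]
    exact ((hS.to_le hYS).to_subgroup ⊤).map θ
  have hi' : ¬ p ∣ (autConj S R ⊓ (F.autF hR ⊓ autStabilizer R Q)).relIndex
      (F.autF hR ⊓ autStabilizer R Q) := by rwa [Subgroup.inf_relIndex_right]
  obtain ⟨ν, hν, hc⟩ := exists_conj_le_of_le_mul inf_le_right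
    ((isPGroup_autConj hS).to_le inf_le_left) hi' hN hNn hYp (by
      rintro _ ⟨y, rfl⟩
      obtain ⟨ν, hν, h⟩ := hYN y y.2 (θ y) (hθH y) (hθ' y)
      exact ⟨ν, hν, h, Subgroup.mul_mem _ (hN hν) (hθH y)⟩)
  have hνf := (mem_autF_iff.1 (hN hν).1).comp hf
  have hνa : ∀ z : R', (extendFun fun x => (ν x : G)) (f z) = ν (α z) := fun z => by
    rw [← ha, extendFun_apply]
  obtain ⟨X, f', hX, hf', hXc⟩ := hr _ _ hνf
  refine ⟨ν, hν, X, f', hX, fun z hz => hXc z (hR' hz) (Subgroup.le_normalizer hz)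
    ⟨_, hνf.cod_le (hνf.mem hz), fun x hx => hνf.map_conj hz hx⟩, fun y hy => ?_, ?_⟩
  · obtain ⟨⟨t, ht, h⟩, -⟩ := hc _ ⟨⟨y, hy⟩, rfl⟩
    refine hXc y (hYS hy) (hYR hy) ⟨t, ht, fun x hx => ?_⟩
    have h1 := h (ν (α ⟨x, hx⟩))
    rw [MulAut.mul_apply, MulAut.mul_apply, MulAut.inv_apply_self] at h1
    have hx' := (Subgroup.mem_normalizer_iff.1 (hYR hy) x).1 hx
    have h2 : θ ⟨y, hy⟩ (α ⟨x, hx⟩) = α ⟨_, hx'⟩ := Subtype.ext (by rw [hθ, ha])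
    rw [Function.comp_apply, Function.comp_apply, hνa ⟨_, hx'⟩, hνa ⟨_, hx⟩, ← h1, h2]
  · intro x z hz hx
    have : x = α ⟨z, hz⟩ := Subtype.ext (by rw [ha]; exact hx)
    rw [hf' z hz, Function.comp_apply, hνa ⟨z, hz⟩, this]

/-- Any isomorphism onto a good pair can be modified so that it extends to the normalizer. -/
theorem GoodPair.exists_extension_normalizer [Fact p.Prime] [Finite S] (hS : IsPGroup p S)
    {hR : R ≤ S} (hp : F.GoodPair p hR Q) (hf : F.IsoOn R' R f) (hfQ : F.IsoOn Q' Q f)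
    (hQ' : Q' ≤ R') :
    ∃ X f', F.MorOn X f' ∧ R' ≤ X ∧ normalizerIn S R' ⊓ normalizerIn S Q' ≤ X ∧
      F.IsoOn R' R f' ∧ F.IsoOn Q' Q f' := by
  -- With `N` the whole stabilizer the condition on `Y` always holds, but `f` may change on `Q'`.
  obtain ⟨ν, hν, X, f', hX, hR'X, hYX, h⟩ := hp.exists_extension hS le_rfl
    (fun a ha b hb => Subgroup.mul_mem _ (Subgroup.mul_mem _ ha hb) (Subgroup.inv_mem _ ha))
    hf hfQ hQ' (Y := normalizerIn S R' ⊓ normalizerIn S Q') (fun y hy => hy.1.1)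
    (fun y hy => hy.1.2) (fun y hy => hy.2.2) (fun y _ β hβ _ =>
      ⟨β⁻¹, Subgroup.inv_mem _ hβ, by rw [inv_mul_cancel]; exact Subgroup.one_mem _⟩)
  have hν' := mem_autF_iff.1 hν.1
  have he : ∀ z ∈ R', f' z = (extendFun fun x => (ν x : G)) (f z) := fun z hz => by
    rw [h ⟨f z, hf.mem hz⟩ z hz rfl, ← extendFun_apply (fun x => (ν x : G))]
  have hνQ : F.IsoOn Q Q (extendFun fun x => (ν x : G)) := by
    refine hν'.restrict_of_iff hp.1 (fun x hx => ?_) fun y hy => ?_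
    · rw [extendFun_apply (P := R) _ ⟨x, hp.1 hx⟩]
      exact (hν.2 ⟨x, hp.1 hx⟩).2 hx
    · refine ⟨(ν⁻¹ ⟨y, hp.1 hy⟩ : R), ?_, ?_⟩
      · rw [← hν.2, MulAut.apply_inv_self]
        exact hy
      · rw [extendFun_apply, MulAut.apply_inv_self]
  exact ⟨X, f', hX, hR'X, hYX, (hν'.comp hf).congr he,
    (hνQ.comp hfQ).congr fun z hz => he z (hQ' hz)⟩

/-- An isomorphism onto a good pair `(R, Q)` can be modified, without changing the restriction to
the preimage of `Q`, so that it extends to elements inducing on `Q` conjugation by elements of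
`N_S(R)`. -/
theorem GoodPair.exists_extension_eqOn [Fact p.Prime] [Finite S] (hS : IsPGroup p S)
    {hR : R ≤ S} (hp : F.GoodPair p hR Q) (hf : F.IsoOn R' R f) (hfQ : F.IsoOn Q' Q f)
    (hQ' : Q' ≤ R') {Y : Subgroup G} (hYS : Y ≤ S)
    (hYR : Y ≤ Subgroup.normalizer (R' : Set G)) (hYQ : Y ≤ Subgroup.normalizer (Q' : Set G))
    (hY : ∀ y ∈ Y, ∃ t ∈ S, t ∈ Subgroup.normalizer (R : Set G) ∧
      ∀ x ∈ Q', f (y * x * y⁻¹) = t * f x * t⁻¹) :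
    ∃ X f', F.MorOn X f' ∧ R' ≤ X ∧ Y ≤ X ∧ F.IsoOn R' R f' ∧ ∀ x ∈ Q', f' x = f x := by
  obtain ⟨ν, hν, X, f', hX, hR'X, hYX, h⟩ := hp.exists_extension hS
    (N := (F.autF hR ⊓ autStabilizer R Q) ⊓ autFixing R Q) inf_le_left
    (fun a ha b hb => ⟨Subgroup.mul_mem _ (Subgroup.mul_mem _ ha hb.1) (Subgroup.inv_mem _ ha),
      fun x hx => by
        have h1 : ((a⁻¹ x : R) : G) ∈ Q := by
          rw [← ha.2, MulAut.apply_inv_self]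
          exact hx
        rw [MulAut.mul_apply, MulAut.mul_apply, hb.2 _ h1, MulAut.apply_inv_self]⟩)
    hf hfQ hQ' hYS hYR hYQ (by
      intro y hy β hβ hβy
      obtain ⟨t, ht, htR, h⟩ := hY y hy
      have htβ : ∀ x : R, (x : G) ∈ Q → β x = R.normalizerMonoidHom ⟨t, htR⟩ x := by
        intro x hx
        obtain ⟨z, hz, hzx⟩ := hfQ.surj hx
        refine Subtype.ext ?_
        rw [hβy x z (hQ' hz) hzx.symm, h z hz, hzx]
        rfl
      have hmemQ : ∀ x : R, ((β⁻¹ x : R) : G) ∈ Q ↔ (x : G) ∈ Q := fun x => by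
        rw [← hβ.2, MulAut.apply_inv_self]
      have htc : R.normalizerMonoidHom ⟨t, htR⟩ ∈ autConj S R := ⟨t, ht, fun x => rfl⟩
      have hfix : R.normalizerMonoidHom ⟨t, htR⟩ * β⁻¹ ∈ autFixing R Q := fun x hx => by
        rw [MulAut.mul_apply, ← htβ _ ((hmemQ x).2 hx), MulAut.apply_inv_self]
      -- On `Q` the automorphism `β` is conjugation by `t`. So `ν = c_t β⁻¹` fixes `Q` pointwise,
      -- while `ν β = c_t` lies in `Aut_S(R)`.
      refine ⟨R.normalizerMonoidHom ⟨t, htR⟩ * β⁻¹, ⟨⟨Subgroup.mul_mem _ (autConj_le_autF hR htc)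
        (Subgroup.inv_mem _ hβ.1), fun x => ⟨fun hx => ?_, fun hx => ?_⟩⟩, hfix⟩, ?_⟩
      · rwa [← (R.normalizerMonoidHom ⟨t, htR⟩ * β⁻¹).injective (hfix _ hx)]
      · rw [hfix x hx]
        exact hx
      · rwa [inv_mul_cancel_right])
  have hν' := mem_autF_iff.1 hν.1.1
  have he : ∀ z ∈ R', f' z = (extendFun fun x => (ν x : G)) (f z) := fun z hz => by
    rw [h ⟨f z, hf.mem hz⟩ z hz rfl, ← extendFun_apply (fun x => (ν x : G))]
  refine ⟨X, f', hX, hR'X, hYX, (hν'.comp hf).congr he, fun z hz => ?_⟩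
  rw [h ⟨f z, hf.mem (hQ' hz)⟩ z (hQ' hz) rfl, hν.2 ⟨f z, hf.mem (hQ' hz)⟩ (hfQ.mem hz)]

end FusionSystem

/-! ### Indices under restriction of automorphisms. -/

section RestrictionIndex

variable {G : Type*} [Group G]

/-- The restriction to `Q` of an automorphism of `U` stabilizing `Q`. -/
def restrictAut {U Q : Subgroup G} (hQ : Q ≤ U) : autStabilizer U Q →* MulAut Q where
  toFun α :=
    { toFun := fun x => ⟨α.1 ⟨x, hQ x.2⟩, (α.2 ⟨x, hQ x.2⟩).2 x.2⟩
      invFun := fun x => ⟨(α⁻¹).1 ⟨x, hQ x.2⟩, ((α⁻¹).2 ⟨x, hQ x.2⟩).2 x.2⟩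
      left_inv := fun x => by simp
      right_inv := fun x => by simp
      map_mul' := fun x y => Subtype.ext (congrArg (fun z : U => (z : G))
        (map_mul α.1 ⟨x, hQ x.2⟩ ⟨y, hQ y.2⟩)) }
  map_one' := rfl
  map_mul' _ _ := rfl

/-- Restriction maps the elements of `D` stabilizing `Q` onto `B`, and those of `D₀` into `B₀`;
under a homomorphism an index is replaced by a divisor. This passes Sylow properties of automorphism
groups from `U` down to `Q`. -/
theorem not_dvd_relIndex_of_restrict {p : ℕ} {U Q : Subgroup G} (hQ : Q ≤ U)
    {D D₀ : Subgroup (MulAut U)} {B B₀ : Subgroup (MulAut Q)}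
    (hi : ¬ p ∣ D₀.relIndex (D ⊓ autStabilizer U Q))
    (hB : ∀ β ∈ B, ∃ α ∈ D, ∀ x : Q, (α (Subgroup.inclusion hQ x) : G) = β x)
    (hD : ∀ α ∈ D, ∀ β : MulAut Q, (∀ x : Q, (α (Subgroup.inclusion hQ x) : G) = β x) → β ∈ B)
    (hD₀ : ∀ α ∈ D₀, ∀ β : MulAut Q, (∀ x : Q, (α (Subgroup.inclusion hQ x) : G) = β x) →
      β ∈ B₀) : ¬ p ∣ B₀.relIndex B := by
  have hBm : B = ((D ⊓ autStabilizer U Q).subgroupOf (autStabilizer U Q)).map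
      (restrictAut hQ) := by
    ext β
    constructor
    · intro hβ
      obtain ⟨α, hα, h⟩ := hB β hβ
      have hs : α ∈ autStabilizer U Q := fun x => by
        constructor
        · intro hx
          have h1 := h (β⁻¹ ⟨_, hx⟩)
          rw [MulAut.apply_inv_self] at h1
          rw [← α.injective (Subtype.ext h1)]
          exact (β⁻¹ _).2
        · intro hx
          have h1 := h ⟨x, hx⟩
          change (α x : G) = _ at h1
          rw [h1]
          exact (β _).2
      exact ⟨⟨α, hs⟩, ⟨hα, hs⟩, MulEquiv.ext fun x => Subtype.ext (h x)⟩
    · rintro ⟨α, hα, rfl⟩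
      exact hD _ hα.1 _ fun x => rfl
  have hB₀ : (D₀.subgroupOf (autStabilizer U Q)).map (restrictAut hQ) ≤ B₀ := by
    rintro _ ⟨α, hα, rfl⟩
    exact hD₀ _ hα _ fun x => rfl
  refine fun h => hi ?_
  rw [← Subgroup.relIndex_subgroupOf (inf_le_right : D ⊓ autStabilizer U Q ≤ _)]
  refine (h.trans (Subgroup.relIndex_dvd_of_le_left _ hB₀)).trans ?_
  rw [hBm]
  exact relIndex_map_dvd _

end RestrictionIndex

/-! ### Orders and normalizers of subgroups of `S`. -/

section Card

variable {G : Type*} [Group G] {S P R : Subgroup G}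

theorem card_le_of_le_of_le [Finite S] (hR : R ≤ S) (h : P ≤ R) : Nat.card P ≤ Nat.card R := by
  have : Finite R := Finite.of_injective _ (Subgroup.inclusion_injective hR)
  exact Nat.card_le_card_of_injective _ (Subgroup.inclusion_injective h)

theorem eq_of_le_of_card_le [Finite S] (hR : R ≤ S) (h : P ≤ R) (hc : Nat.card R ≤ Nat.card P) :
    P = R := by
  have : Finite R := Finite.of_injective _ (Subgroup.inclusion_injective hR)
  exact Subgroup.eq_of_le_of_card_ge h hc

theorem card_lt_of_lt_of_le [Finite S] (hR : R ≤ S) (h : P < R) : Nat.card P < Nat.card R :=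
  lt_of_not_ge fun hc => h.ne (eq_of_le_of_card_le hR h.le hc)

theorem exists_mem_normalizerIn_notMem {p : ℕ} [Fact p.Prime] [Finite S] (hS : IsPGroup p S)
    (hR : R ≤ S) (h : P < R) : ∃ g ∈ R, g ∈ normalizerIn S P ∧ g ∉ P := by
  have : Finite R := Finite.of_injective _ (Subgroup.inclusion_injective hR)
  obtain ⟨g, hg, hn, hP⟩ := exists_mem_normalizer_notMem (hS.to_le hR) h
  exact ⟨g, hg, ⟨hR hg, hn⟩, hP⟩

theorem le_normalizerIn (hP : P ≤ S) : P ≤ normalizerIn S P :=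
  le_inf hP Subgroup.le_normalizer

theorem centralizerIn_le_normalizerIn : centralizerIn S P ≤ normalizerIn S P := by
  rintro x ⟨hx, hc⟩
  refine ⟨hx, Subgroup.mem_normalizer_iff.2 fun y => ?_⟩
  replace hc := Subgroup.mem_centralizer_iff.1 hc
  constructor
  · intro hy
    rw [← hc y hy, mul_inv_cancel_right]
    exact hy
  · intro hy
    have := hc _ hy
    have h2 : y = x * y * x⁻¹ := by
      have h3 : x * y = x * (x * y * x⁻¹) := by simpa using this
      exact mul_left_cancel h3
    rw [h2]
    exact hy

end Card

/-! ### Morphisms defined on normalizers, and common targets in a conjugacy class. -/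

namespace FusionSystem

variable {G : Type*} [Group G] {S : Subgroup G} {F : FusionSystem S}
  {P Q R P' Q' : Subgroup G} {f g : G → G}

theorem IsoOn.symm_pair (hf : F.IsoOn R R' f) (hfP : F.IsoOn P P' f) (hP : P ≤ R) :
    ∃ g, F.IsoOn R' R g ∧ F.IsoOn P' P g ∧ (∀ x ∈ R, g (f x) = x) ∧ ∀ y ∈ R', f (g y) = y := by
  obtain ⟨g, hg, h1, h2⟩ := hf.symm
  have hP' : P' ≤ R' := fun y hy => by
    obtain ⟨x, hx, rfl⟩ := hfP.surj hy
    exact hf.mem (hP hx)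
  refine ⟨g, hg, hg.restrict_of_iff hP' (fun y hy => ?_) fun x hx => ⟨f x, hfP.mem hx, h1 x (hP hx)⟩,
    h1, h2⟩
  obtain ⟨x, hx, rfl⟩ := hfP.surj hy
  rwa [h1 x (hP hx)]

/-- The image of a group normalizing `P` normalizes the image of `P`. -/
theorem IsoOn.le_normalizerIn (hf : F.IsoOn R R' f) (hfP : F.IsoOn P P' f) (hP : P ≤ R)
    (hR : R ≤ Subgroup.normalizer (P : Set G)) : R' ≤ normalizerIn S P' := by
  refine le_inf hf.cod_le fun y hy => ?_
  obtain ⟨r, hr, rfl⟩ := hf.surj hy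
  have key : ∀ s ∈ R, ∀ z ∈ P', f s * z * (f s)⁻¹ ∈ P' := by
    intro s hs z hz
    obtain ⟨x, hx, rfl⟩ := hfP.surj hz
    rw [← hf.map_conj hs (hP hx)]
    exact hfP.mem ((Subgroup.mem_normalizer_iff.1 (hR hs) x).1 hx)
  refine Subgroup.mem_normalizer_iff.2 fun z => ⟨key r hr z, fun hz => ?_⟩
  have := key r⁻¹ (R.inv_mem hr) _ hz
  rw [hf.map_inv hr] at this
  simpa [mul_assoc] using this

theorem IsoOn.map_sup_mem (hf : F.IsoOn R R' f) {A B V : Subgroup G} (hA : A ≤ R) (hB : B ≤ R)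
    (hAV : ∀ x ∈ A, f x ∈ V) (hBV : ∀ x ∈ B, f x ∈ V) : ∀ x ∈ A ⊔ B, f x ∈ V := by
  let W : Subgroup G :=
    { carrier := {x | x ∈ R ∧ f x ∈ V}
      one_mem' := ⟨R.one_mem, by rw [hf.map_one]; exact V.one_mem⟩
      mul_mem' := fun ha hb => ⟨R.mul_mem ha.1 hb.1, by
        rw [hf.map_mul ha.1 hb.1]; exact V.mul_mem ha.2 hb.2⟩
      inv_mem' := fun ha => ⟨R.inv_mem ha.1, by rw [hf.map_inv ha.1]; exact V.inv_mem ha.2⟩ }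
  have : A ⊔ B ≤ W := sup_le (fun x hx => ⟨hA hx, hAV x hx⟩) fun x hx => ⟨hB hx, hBV x hx⟩
  exact fun x hx => (this hx).2

theorem IsoOn.map_centralizerIn (hf : F.IsoOn R R' f) (hfP : F.IsoOn P P' f) (hP : P ≤ R) {x : G}
    (hxR : x ∈ R) (hx : x ∈ centralizerIn S P) : f x ∈ centralizerIn S P' := by
  refine ⟨hf.cod_le (hf.mem hxR), Subgroup.mem_centralizer_iff.2 fun y hy => ?_⟩
  obtain ⟨z, hz, rfl⟩ := hfP.surj hy
  rw [← hf.map_mul (hP hz) hxR, ← hf.map_mul hxR (hP hz),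
    Subgroup.mem_centralizer_iff.1 hx.2 z hz]

/-- There is a morphism defined on `N_S(P)` which sends `P` to `Q`. -/
def NormalizerArrow (F : FusionSystem S) (P Q : Subgroup G) : Prop :=
  ∃ f M, F.IsoOn (normalizerIn S P) M f ∧ F.IsoOn P Q f

theorem NormalizerArrow.refl (hP : P ≤ S) : F.NormalizerArrow P P :=
  ⟨id, _, IsoOn.refl inf_le_left, IsoOn.refl hP⟩

theorem NormalizerArrow.trans (h₁ : F.NormalizerArrow P Q) (h₂ : F.NormalizerArrow Q R) :
    F.NormalizerArrow P R := by
  obtain ⟨f, M, hf, hfP⟩ := h₁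
  obtain ⟨g, N, hg, hgQ⟩ := h₂
  obtain ⟨M', _, hg'⟩ := hg.restrict
    (hf.le_normalizerIn hfP (_root_.le_normalizerIn hfP.dom_le) inf_le_right)
  exact ⟨g ∘ f, M', hg'.comp hf, hgQ.comp hfP⟩

theorem NormalizerArrow.card_le [Finite S] (h : F.NormalizerArrow P Q) :
    Nat.card (normalizerIn S P) ≤ Nat.card (normalizerIn S Q) := by
  obtain ⟨f, M, hf, hfP⟩ := h
  rw [hf.card_eq]
  exact card_le_of_le_of_le inf_le_left
    (hf.le_normalizerIn hfP (_root_.le_normalizerIn hfP.dom_le) inf_le_right)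

/-- The morphism on `N_S(P)` has image in `N_S(Q)`; the orders force it to be onto, so it can be
inverted. -/
theorem NormalizerArrow.symm_of_card_le [Finite S] (h : F.NormalizerArrow P Q)
    (hc : Nat.card (normalizerIn S Q) ≤ Nat.card (normalizerIn S P)) : F.NormalizerArrow Q P := by
  obtain ⟨f, M, hf, hfP⟩ := h
  obtain rfl : M = normalizerIn S Q := eq_of_le_of_card_le inf_le_left
    (hf.le_normalizerIn hfP (_root_.le_normalizerIn hfP.dom_le) inf_le_right)
    (by rwa [← hf.card_eq])
  obtain ⟨g, hg, hgQ, -, -⟩ := hf.symm_pair hfP (_root_.le_normalizerIn hfP.dom_le)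
  exact ⟨g, _, hg, hgQ⟩

/-- Composites of isomorphisms which extend to strictly larger subgroups. -/
inductive ExtChain (F : FusionSystem S) (P : Subgroup G) : Subgroup G → (G → G) → Prop
  | refl (f : G → G) (hf : ∀ x ∈ P, f x = x) : ExtChain F P P f
  | step (Q R : Subgroup G) (f g h : G → G) (hf : ExtChain F P Q f) (hg : F.IsoOn Q R g)
      (X : Subgroup G) (hX : Q < X) (hgX : F.MorOn X g) (hh : ∀ x ∈ P, h x = g (f x)) :
      ExtChain F P R h

theorem ExtChain.isoOn (hP : P ≤ S) (h : F.ExtChain P Q f) : F.IsoOn P Q f := by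
  induction h with
  | refl f hf => exact (IsoOn.refl hP).congr hf
  | step Q R f g h _ hg X _ _ hh ih => exact (hg.comp ih).congr hh

variable {p : ℕ} [Fact p.Prime] [Finite S]

theorem GoodPair.exists_extension_inf (hS : IsPGroup p S) {R₁ P₁ : Subgroup G} {hR₁ : R₁ ≤ S}
    (hgood : F.GoodPair p hR₁ P₁) (hf : F.IsoOn R R₁ f) (hfP : F.IsoOn P P₁ f) (hP : P ≤ R) :
    ∃ f' M, F.IsoOn (normalizerIn S R ⊓ normalizerIn S P) M f' ∧ F.IsoOn P P₁ f' := by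
  obtain ⟨X, f', ⟨M, hX⟩, -, hle, -, hP'⟩ := hgood.exists_extension_normalizer hS hf hfP hP
  obtain ⟨M', -, hM'⟩ := hX.restrict hle
  exact ⟨f', M', hM', hP'⟩

/-- If `R < N_S(P)`, then an element of `N_S(P)` outside `R` normalizes `R`. -/
theorem eq_normalizerIn_of_inf_eq (hS : IsPGroup p S) (hRS : R ≤ S)
    (hR : R ≤ Subgroup.normalizer (P : Set G))
    (h : normalizerIn S R ⊓ normalizerIn S P = R) : normalizerIn S P = R := by
  by_contra hne
  have hlt : R < normalizerIn S P := lt_of_le_of_ne (le_inf hRS hR) (Ne.symm hne)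
  obtain ⟨g, hg, hn, hgR⟩ := exists_mem_normalizerIn_notMem hS inf_le_left hlt
  exact hgR (h ▸ ⟨hn, hg⟩)

/-- Map `(R₁, P₁)` to a good pair `(R₀, P₀)`, compare both `P₁` and `P₂` with `P₀`, and induct on
the index of `R₁` in `S`. This is where saturation at larger subgroups is used to align normalizers.
-/
theorem exists_common_target (hS : IsPGroup p S) {n : ℕ}
    (hsat : ∀ R ≤ S, n < Nat.card R → F.SaturatedAt p R) (R₁ R₂ P₁ P₂ : Subgroup G) (f : G → G)
    (hn : n < Nat.card R₁) (hP : P₁ ≤ R₁) (hR : R₁ ≤ Subgroup.normalizer (P₁ : Set G))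
    (hf : F.IsoOn R₁ R₂ f) (hfP : F.IsoOn P₁ P₂ f) :
    ∃ P₃, F.NormalizerArrow P₁ P₃ ∧ F.NormalizerArrow P₂ P₃ := by
  induction hk : Nat.card S - Nat.card R₁ using Nat.strong_induction_on
    generalizing R₁ R₂ P₁ P₂ f with
  | _ k ih =>
  obtain ⟨R₀, P₀, hR₀, g, hg, hgP, hgood⟩ := exists_goodPair hS (hsat R₁ hf.dom_le hn) hP
  obtain ⟨f', hf', hfP', -, -⟩ := hf.symm_pair hfP hP
  have hP₂ : P₂ ≤ R₂ := fun y hy => by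
    obtain ⟨x, hx, rfl⟩ := hfP.surj hy
    exact hf.mem (hP hx)
  have hR₂ : R₂ ≤ Subgroup.normalizer (P₂ : Set G) :=
    (hf.le_normalizerIn hfP hP hR).trans inf_le_right
  have hR₀P : R₀ ≤ normalizerIn S P₀ := hg.le_normalizerIn hgP hP hR
  -- The map onto `R₀` can be modified to extend to `N_S(R) ∩ N_S(P)`. If this equals `R`, then `R`
  -- is all of `N_S(P)` and the map is already an arrow to `P₀`; otherwise the domain has grown and
  -- induction applies.
  have harrow : ∀ (R P : Subgroup G) (g' : G → G), P ≤ R → R ≤ Subgroup.normalizer (P : Set G) → F.IsoOn R R₀ g' →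
      F.IsoOn P P₀ g' → (normalizerIn S R ⊓ normalizerIn S P = R ∧ F.NormalizerArrow P P₀) ∨
      (Nat.card R < Nat.card (normalizerIn S P₀) ∧
        ∃ P₃, F.NormalizerArrow P P₃ ∧ F.NormalizerArrow P₀ P₃) := by
    intro R P g' hPR hRP hg' hgP'
    obtain ⟨a, M, ha, haP⟩ := hgood.exists_extension_inf hS hg' hgP' hPR
    have hRY : R ≤ normalizerIn S R ⊓ normalizerIn S P :=
      le_inf (le_normalizerIn hg'.dom_le) (le_inf hg'.dom_le hRP)
    by_cases hY : normalizerIn S R ⊓ normalizerIn S P = R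
    · left
      refine ⟨hY, a, M, ?_, haP⟩
      rwa [eq_normalizerIn_of_inf_eq hS hg'.dom_le hRP hY, ← hY]
    · right
      have hlt : Nat.card R < Nat.card ↥(normalizerIn S R ⊓ normalizerIn S P) :=
        card_lt_of_lt_of_le ha.dom_le (lt_of_le_of_ne hRY (Ne.symm hY))
      have hle := card_le_of_le_of_le le_rfl ha.dom_le
      have hMP : Nat.card M ≤ Nat.card (normalizerIn S P₀) := card_le_of_le_of_le (S := S) inf_le_left
        (ha.le_normalizerIn haP (hPR.trans hRY) (inf_le_right.trans inf_le_right))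
      have hcR : Nat.card R = Nat.card R₁ := hg'.card_eq.trans hg.card_eq.symm
      refine ⟨by rw [ha.card_eq] at hlt; omega, ?_⟩
      exact ih _ (by omega) _ _ _ _ a (by omega) (hPR.trans hRY)
        (inf_le_right.trans inf_le_right) ha haP rfl
  have hcR : Nat.card R₂ = Nat.card R₁ := hf.card_eq.symm
  have hA₁ := harrow R₁ P₁ g hP hR hg hgP
  have hA₂ := harrow R₂ P₂ _ hP₂ hR₂ (hg.comp hf') (hgP.comp hfP')
  have hrefl : F.NormalizerArrow P₀ P₀ := NormalizerArrow.refl hgP.cod_le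
  -- If `N_S(P₀)` is larger than `R₁`, the targets `P₄` and `P₅` are joined by an isomorphism
  -- defined on the image of `N_S(P₀)`, to which induction applies. If not, the growing alternative
  -- is impossible on both sides, and `P₀` itself is the target.
  by_cases hc : Nat.card R₁ < Nat.card (normalizerIn S P₀)
  · obtain ⟨P₄, h14, a, A, ha, haP⟩ : ∃ P₃, F.NormalizerArrow P₁ P₃ ∧ F.NormalizerArrow P₀ P₃ :=
      hA₁.elim (fun h => ⟨P₀, h.2, hrefl⟩) fun h => h.2
    obtain ⟨P₅, h25, b, B, hb, hbP⟩ : ∃ P₃, F.NormalizerArrow P₂ P₃ ∧ F.NormalizerArrow P₀ P₃ :=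
      hA₂.elim (fun h => ⟨P₀, h.2, hrefl⟩) fun h => h.2
    obtain ⟨a', ha', haP', -, -⟩ := ha.symm_pair haP (le_normalizerIn hgP.cod_le)
    have hle := card_le_of_le_of_le le_rfl ha.cod_le
    have hcA := ha.card_eq
    obtain ⟨P₆, h46, h56⟩ := ih _ (by omega) A B P₄ P₅ (b ∘ a') (by omega)
      (fun y hy => by
        obtain ⟨x, hx, rfl⟩ := haP.surj hy
        exact ha.mem (le_normalizerIn hgP.cod_le hx))
      ((ha.le_normalizerIn haP (le_normalizerIn hgP.cod_le) inf_le_right).trans inf_le_right)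
      (hb.comp ha') (hbP.comp haP') rfl
    exact ⟨P₆, h14.trans h46, h25.trans h56⟩
  · exact ⟨P₀, hA₁.elim (fun h => h.2) fun h => absurd h.1 hc,
      hA₂.elim (fun h => h.2) fun h => absurd (hcR ▸ h.1) hc⟩

theorem NormalizerArrow.exists_common_target (hS : IsPGroup p S) {n : ℕ}
    (hsat : ∀ R ≤ S, n < Nat.card R → F.SaturatedAt p R) (hP : n < Nat.card (normalizerIn S P))
    (h₁ : F.NormalizerArrow P Q) (h₂ : F.NormalizerArrow P R) :
    ∃ P', F.NormalizerArrow Q P' ∧ F.NormalizerArrow R P' := by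
  obtain ⟨a, A, ha, haP⟩ := h₁
  obtain ⟨b, B, hb, hbP⟩ := h₂
  have hPN := _root_.le_normalizerIn haP.dom_le
  obtain ⟨a', ha', haP', -, -⟩ := ha.symm_pair haP hPN
  refine FusionSystem.exists_common_target hS hsat A B Q R (b ∘ a') (by rwa [← ha.card_eq])
    (fun y hy => ?_) ((ha.le_normalizerIn haP hPN inf_le_right).trans inf_le_right)
    (hb.comp ha') (hbP.comp haP')
  obtain ⟨x, hx, rfl⟩ := haP.surj hy
  exact ha.mem (hPN hx)

/-- Each link extends to a group `X > Q`, and `X ∩ N_S(Q)` is still larger than `Q`, so each link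
has a common target. Common targets of successive links are then merged. -/
theorem ExtChain.exists_common_target (hS : IsPGroup p S)
    (hsat : ∀ R ≤ S, Nat.card P < Nat.card R → F.SaturatedAt p R) (hP : P ≤ S)
    (h : F.ExtChain P Q f) : ∃ P', F.NormalizerArrow P P' ∧ F.NormalizerArrow Q P' := by
  induction h with
  | refl f hf => exact ⟨P, NormalizerArrow.refl hP, NormalizerArrow.refl hP⟩
  | step Q R f g h hf hg X hX hgX hh ih =>
    obtain ⟨A, hPA, hQA⟩ := ih
    obtain ⟨V, hgV⟩ := hgX
    have hc := (hf.isoOn hP).card_eq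
    have hQX : Q < X ⊓ normalizerIn S Q := by
      obtain ⟨y, hy, hn, hyQ⟩ := exists_mem_normalizerIn_notMem hS hgV.dom_le hX
      exact lt_of_le_of_ne (le_inf hX.le (le_normalizerIn hg.dom_le)) fun he =>
        hyQ (he ▸ ⟨hy, hn⟩)
    have hcX : Nat.card Q < Nat.card ↥(X ⊓ normalizerIn S Q) :=
      card_lt_of_lt_of_le (S := S) (inf_le_left.trans hgV.dom_le) hQX
    have hcN := card_le_of_le_of_le (S := S) (R := normalizerIn S Q) inf_le_left
      (inf_le_right : X ⊓ normalizerIn S Q ≤ _)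
    obtain ⟨W, -, hgW⟩ := hgV.restrict (inf_le_left : X ⊓ normalizerIn S Q ≤ X)
    obtain ⟨B, hQB, hRB⟩ := FusionSystem.exists_common_target hS hsat _ _ _ _ g (by omega) hQX.le
      (inf_le_right.trans inf_le_right) hgW hg
    obtain ⟨C, hAC, hBC⟩ := hQA.exists_common_target hS hsat (by omega) hQB
    exact ⟨C, hPA.trans hAC, hRB.trans hBC⟩

/-- A conjugacy class of subgroups in which isomorphisms are composites of isomorphisms that extend
to larger subgroups has a member to which the normalizers of all others map. -/
theorem exists_normalizerArrow_target (hS : IsPGroup p S) (hP : P ≤ S)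
    (hsat : ∀ R ≤ S, Nat.card P < Nat.card R → F.SaturatedAt p R)
    (hgen : ∀ A B f g, F.IsoOn P A f → F.IsoOn A B g → F.ExtChain A B g) :
    ∃ Q f, F.IsoOn P Q f ∧ ∀ A g, F.IsoOn P A g → F.NormalizerArrow A Q := by
  let N : Set ℕ := {m | ∃ Q f, F.IsoOn P Q f ∧ Nat.card (normalizerIn S Q) = m}
  have hN : N.Nonempty := ⟨_, P, id, IsoOn.refl hP, rfl⟩
  have hb : BddAbove N := ⟨Nat.card S, by
    rintro m ⟨Q, f, -, rfl⟩
    exact card_le_of_le_of_le le_rfl inf_le_left⟩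
  obtain ⟨Q, f, hf, hQ⟩ := Nat.sSup_mem hN hb
  refine ⟨Q, f, hf, fun A g hg => ?_⟩
  obtain ⟨f', hf', -, -⟩ := hf.symm
  obtain ⟨C, hQC, hAC⟩ := (hgen Q A f _ hf (hg.comp hf')).exists_common_target hS
    (by rwa [← hf.card_eq]) hf.cod_le
  refine hAC.trans (hQC.symm_of_card_le ?_)
  rw [hQ]
  obtain ⟨c, M, -, hc⟩ := hQC
  exact le_csSup hb ⟨C, _, hc.comp hf, rfl⟩

end FusionSystem

/-! ### Extension to `Q C_S(Q)`, and saturation at noncentric classes. -/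

namespace FusionSystem

variable {G : Type*} [Group G] {S : Subgroup G} {F : FusionSystem S}
  {P Q R P' Q' : Subgroup G} {f g : G → G}

/-- The restriction of `f` to `Q` extends to an automorphism of `Q C_S(Q)` in `F`. -/
def ExtendsToCentralizer (F : FusionSystem S) (Q : Subgroup G) (f : G → G) : Prop :=
  ∃ f', F.IsoOn (Q ⊔ centralizerIn S Q) (Q ⊔ centralizerIn S Q) f' ∧ ∀ x ∈ Q, f' x = f x

theorem sup_centralizerIn_le (hQ : Q ≤ S) : Q ⊔ centralizerIn S Q ≤ normalizerIn S Q :=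
  sup_le (le_normalizerIn hQ) centralizerIn_le_normalizerIn

theorem IsoOn.extendsToCentralizer [Finite S] (hf : F.IsoOn R R' f) (hfQ : F.IsoOn Q Q f)
    (hQ : Q ≤ R) (hC : centralizerIn S Q ≤ R) : F.ExtendsToCentralizer Q f := by
  obtain ⟨V, -, hV⟩ := hf.restrict (sup_le hQ hC)
  have hle : V ≤ Q ⊔ centralizerIn S Q := fun y hy => by
    obtain ⟨x, hx, rfl⟩ := hV.surj hy
    exact hf.map_sup_mem hQ hC (fun x hx => le_sup_left (a := Q) (hfQ.mem hx))
      (fun x hx => le_sup_right (a := Q) (hf.map_centralizerIn hfQ hQ (hC hx) hx)) x hx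
  obtain rfl := eq_of_le_of_card_le hV.dom_le hle hV.card_eq.le
  exact ⟨f, hV, fun _ _ => rfl⟩

namespace ExtendsToCentralizer

theorem congr (h : F.ExtendsToCentralizer Q f) (hfg : ∀ x ∈ Q, g x = f x) :
    F.ExtendsToCentralizer Q g := by
  obtain ⟨f', hf', h⟩ := h
  exact ⟨f', hf', fun x hx => (h x hx).trans (hfg x hx).symm⟩

theorem comp (hg : F.ExtendsToCentralizer Q g) (hf : F.ExtendsToCentralizer Q f)
    (hfQ : ∀ x ∈ Q, f x ∈ Q) : F.ExtendsToCentralizer Q (g ∘ f) := by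
  obtain ⟨f', hf', h⟩ := hf
  obtain ⟨g', hg', h'⟩ := hg
  exact ⟨_, hg'.comp hf', fun x hx => by
    rw [Function.comp_apply, h x hx, h' _ (hfQ x hx), Function.comp_apply]⟩

/-- On `Q` one has `k = g⁻¹ ∘ f`, and the extensions of `g` and `f` compose accordingly. -/
theorem of_comp_eq {k : G → G} (hg : F.ExtendsToCentralizer Q g) (hf : F.ExtendsToCentralizer Q f)
    (hkQ : ∀ x ∈ Q, k x ∈ Q) (hk : ∀ x ∈ Q, g (k x) = f x) : F.ExtendsToCentralizer Q k := by
  obtain ⟨f', hf', h⟩ := hf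
  obtain ⟨g', hg', h'⟩ := hg
  obtain ⟨i, hi, hig, -⟩ := hg'.symm
  exact ⟨_, hi.comp hf', fun x hx => by
    rw [Function.comp_apply, h x hx, ← hk x hx, ← h' _ (hkQ x hx),
      hig _ (le_sup_left (a := Q) (hkQ x hx))]⟩

end ExtendsToCentralizer

theorem conj_mem_centralizerIn {r c : G} (hr : r ∈ normalizerIn S Q) (hc : c ∈ centralizerIn S Q) :
    r * c * r⁻¹ ∈ centralizerIn S Q := by
  refine ⟨S.mul_mem (S.mul_mem hr.1 hc.1) (S.inv_mem hr.1),
    Subgroup.mem_centralizer_iff.2 fun y hy => ?_⟩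
  have hy' : r⁻¹ * y * r ∈ Q := by
    have := (Subgroup.mem_normalizer_iff.1 (Subgroup.inv_mem _ hr.2) y).1 hy
    simpa using this
  have := Subgroup.mem_centralizer_iff.1 hc.2 _ hy'
  calc y * (r * c * r⁻¹) = r * ((r⁻¹ * y * r) * c) * r⁻¹ := by group
    _ = r * (c * (r⁻¹ * y * r)) * r⁻¹ := by rw [this]
    _ = r * c * r⁻¹ * y := by group

theorem mem_autF_of_restrict {U : Subgroup G} {hU : U ≤ S} (hQU : Q ≤ U) (hQ : Q ≤ S) {α : MulAut U}
    (hα : α ∈ F.autF hU) {β : MulAut Q}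
    (h : ∀ x : Q, (α (Subgroup.inclusion hQU x) : G) = β x) : β ∈ F.autF hQ := by
  have he : ∀ x : Q, extendFun (fun x => (α x : G)) (x : G) = β x := fun x =>
    (extendFun_apply (fun x => (α x : G)) (Subgroup.inclusion hQU x)).trans (h x)
  refine mem_autF_iff.2 (((mem_autF_iff.1 hα).restrict_of_iff hQU (fun x hx => ?_)
    fun y hy => ⟨(β⁻¹ ⟨y, hy⟩ : Q), (β⁻¹ _).2, ?_⟩).congr fun x hx => ?_)
  · rw [he ⟨x, hx⟩]
    exact (β _).2
  · rw [he, MulAut.apply_inv_self]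
  · rw [he ⟨x, hx⟩, extendFun_apply (P := Q) _ ⟨x, hx⟩]

theorem mem_normalizer_of_isoOn (hf : F.IsoOn P Q f) {s t : G}
    (hs : s ∈ Subgroup.normalizer (P : Set G))
    (h : ∀ x ∈ P, f (s * x * s⁻¹) = t * f x * t⁻¹) : t ∈ Subgroup.normalizer (Q : Set G) := by
  refine Subgroup.mem_normalizer_iff.2 fun y => ⟨fun hy => ?_, fun hy => ?_⟩
  · obtain ⟨x, hx, rfl⟩ := hf.surj hy
    rw [← h x hx]
    exact hf.mem ((Subgroup.mem_normalizer_iff.1 hs x).1 hx)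
  · obtain ⟨x, hx, hxy⟩ := hf.surj hy
    have hx' : s⁻¹ * x * s ∈ P := by
      have := (Subgroup.mem_normalizer_iff.1 (Subgroup.inv_mem _ hs) x).1 hx
      simpa using this
    have h1 := h _ hx'
    have h2 : s * (s⁻¹ * x * s) * s⁻¹ = x := by group
    rw [h2, hxy] at h1
    have h3 : y = f (s⁻¹ * x * s) := by simpa using h1
    rw [h3]
    exact hf.mem hx'

theorem normalizerIn_le_normalizer_sup :
    normalizerIn S Q ≤ Subgroup.normalizer ((Q ⊔ centralizerIn S Q : Subgroup G) : Set G) := by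
  have key : ∀ g ∈ normalizerIn S Q, ∀ x ∈ Q ⊔ centralizerIn S Q,
      g * x * g⁻¹ ∈ Q ⊔ centralizerIn S Q := by
    intro g hg
    have : Q ⊔ centralizerIn S Q ≤
        (Q ⊔ centralizerIn S Q).comap (MulAut.conj g).toMonoidHom :=
      sup_le (fun x hx => le_sup_left (a := Q) ((Subgroup.mem_normalizer_iff.1 hg.2 x).1 hx))
        fun x hx => le_sup_right (a := Q) (conj_mem_centralizerIn hg hx)
    exact fun x hx => this hx
  intro g hg
  refine Subgroup.mem_normalizer_iff.2 fun x => ⟨key g hg x, fun hx => ?_⟩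
  have := key _ (Subgroup.inv_mem _ hg) _ hx
  simpa [mul_assoc] using this

/-- Normalizers grow in the product `W = R C_S(Q)`; modulo `R`, the new normalizing element can be
taken in `C_S(Q)`. -/
theorem exists_centralizer_normalizer_notMem {p : ℕ} [Fact p.Prime] [Finite S] (hS : IsPGroup p S)
    (hR : R ≤ normalizerIn S Q) (hC : ¬ centralizerIn S Q ≤ R) :
    ∃ c ∈ centralizerIn S Q, c ∈ Subgroup.normalizer (R : Set G) ∧ c ∉ R := by
  have hRS : R ≤ S := hR.trans inf_le_left
  have hconj : ∀ r ∈ R, ∀ c ∈ centralizerIn S Q, r * c * r⁻¹ ∈ centralizerIn S Q :=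
    fun r hr c hc => conj_mem_centralizerIn (hR hr) hc
  let W : Subgroup G :=
    { carrier := {x | ∃ r ∈ R, r⁻¹ * x ∈ centralizerIn S Q}
      one_mem' := ⟨1, R.one_mem, by simp⟩
      mul_mem' := by
        rintro a b ⟨r, hr, ha⟩ ⟨s, hs, hb⟩
        refine ⟨r * s, R.mul_mem hr hs, ?_⟩
        have h1 := Subgroup.mul_mem _ (hconj _ (R.inv_mem hs) _ ha) hb
        have h2 : (s⁻¹ * (r⁻¹ * a) * s⁻¹⁻¹) * (s⁻¹ * b) = (r * s)⁻¹ * (a * b) := by group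
        rwa [h2] at h1
      inv_mem' := by
        rintro a ⟨r, hr, ha⟩
        refine ⟨r⁻¹, R.inv_mem hr, ?_⟩
        have h1 := hconj _ hr _ (Subgroup.inv_mem _ ha)
        have h2 : r * (r⁻¹ * a)⁻¹ * r⁻¹ = r⁻¹⁻¹ * a⁻¹ := by group
        rwa [h2] at h1 }
  have hRW : R ≤ W := fun r hr => ⟨r, hr, by simp⟩
  have hCW : centralizerIn S Q ≤ W := fun c hc => ⟨1, R.one_mem, by simpa using hc⟩
  have hWS : W ≤ S := by
    rintro x ⟨r, hr, hx⟩
    have := S.mul_mem (hRS hr) hx.1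
    rwa [mul_inv_cancel_left] at this
  obtain ⟨x, ⟨r, hr, hx⟩, hn, hxR⟩ := exists_mem_normalizerIn_notMem hS hWS
    (lt_of_le_of_ne hRW fun he => hC (he ▸ hCW))
  refine ⟨r⁻¹ * x, hx, Subgroup.mul_mem _ (Subgroup.inv_mem _ (Subgroup.le_normalizer hr)) hn.2,
    fun h => hxR ?_⟩
  have := R.mul_mem hr h
  rwa [mul_inv_cancel_left] at this

/-- As every `F`-automorphism of `Q` extends to `U`, restriction is onto `Aut_F(Q)` and carries the
Sylow property down from `U`. -/
theorem automized_of_goodPair {p : ℕ} {U : Subgroup G} {hU : U ≤ S} (hgood : F.GoodPair p hU Q)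
    (hUQ : U = Q ⊔ centralizerIn S Q) (hQ : Q ≤ S)
    (hext : ∀ f, F.IsoOn Q Q f → F.ExtendsToCentralizer Q f) : F.Automized p hQ := by
  refine not_dvd_relIndex_of_restrict hgood.1 hgood.2.2 ?_ ?_ ?_
  · intro β hβ
    obtain ⟨f, hf, hfβ⟩ := hext _ (mem_autF_iff.1 hβ)
    rw [← hUQ] at hf
    obtain ⟨α, hα, h⟩ := exists_mem_autF hf
    refine ⟨α, hα, fun x => ?_⟩
    rw [h, Subgroup.coe_inclusion, hfβ x x.2, extendFun_apply]
  · exact fun α hα β h => mem_autF_of_restrict hgood.1 hQ hα h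
  · rintro α ⟨t, ht, h⟩ β hβ
    exact ⟨t, ht, fun x => by rw [← hβ, h]; rfl⟩

variable {p : ℕ} [Fact p.Prime] [Finite S]

/-- Map `R` by `g` to a good pair `(R₀, Q₀)` and return by an arrow `ψ` taking `Q₀` to `Q`. On `Q`,
`k` is the quotient of `ψ ∘ g` and `ψ ∘ g ∘ k⁻¹`, so maps of the form `ψ ∘ a` suffice. If the domain
of `a` misses part of `C_S(Q)`, then `a` can be changed off `Q` so as to extend to more of `C_S(Q)`,
which acts trivially on `Q`; the enlarged domain allows induction. -/
theorem extendsToCentralizer_of_isoOn (hS : IsPGroup p S) {n : ℕ}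
    (hsat : ∀ R ≤ S, n < Nat.card R → F.SaturatedAt p R)
    (htop : ∀ P f, F.IsoOn Q P f → F.NormalizerArrow P Q) (R R' : Subgroup G) (k : G → G)
    (hn : n < Nat.card R) (hQR : Q ≤ R) (hR : R ≤ normalizerIn S Q) (hk : F.IsoOn R R' k)
    (hkQ : F.IsoOn Q Q k) : F.ExtendsToCentralizer Q k := by
  induction hm : Nat.card S - Nat.card R using Nat.strong_induction_on
    generalizing R R' k with
  | _ m ih =>
  obtain ⟨R₀, Q₀, hR₀, g, hg, hgQ, hgood⟩ := exists_goodPair hS (hsat R hk.dom_le hn) hQR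
  obtain ⟨ψ, M, hψ, hψQ⟩ := htop _ _ hgQ
  have key : ∀ (T : Subgroup G) (a : G → G), Q ≤ T → T ≤ normalizerIn S Q → F.IsoOn T R₀ a →
      F.IsoOn Q Q₀ a → F.ExtendsToCentralizer Q (ψ ∘ a) := by
    intro T a hQT hT ha haQ
    by_cases hC : centralizerIn S Q ≤ T
    · obtain ⟨M', -, hM'⟩ := hψ.restrict (ha.le_normalizerIn haQ hQT (hT.trans inf_le_right))
      exact (hM'.comp ha).extendsToCentralizer (hψQ.comp haQ) hQT hC
    · obtain ⟨c, hc, hcT, hcn⟩ := exists_centralizer_normalizer_notMem hS hT hC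
      obtain ⟨X, a', ⟨V, hX⟩, hTX, hYX, -, ha'⟩ := hgood.exists_extension_eqOn hS ha haQ hQT
        (Y := centralizerIn S Q ⊓ Subgroup.normalizer (T : Set G)) (fun y hy => hy.1.1)
        inf_le_right (inf_le_left.trans (centralizerIn_le_normalizerIn.trans inf_le_right))
        (fun y hy => ⟨1, S.one_mem, Subgroup.one_mem _, fun x hx => by
          rw [← Subgroup.mem_centralizer_iff.1 hy.1.2 x hx]
          simp⟩)
      have haQ' : F.IsoOn Q Q₀ a' := haQ.congr ha'
      have hTX' : T < X ⊓ normalizerIn S Q :=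
        lt_of_le_of_ne (le_inf hTX hT) fun he => hcn (he ▸
          ⟨hYX ⟨hc, hcT⟩, centralizerIn_le_normalizerIn hc⟩)
      have hlt : Nat.card T < Nat.card ↥(X ⊓ normalizerIn S Q) :=
        card_lt_of_lt_of_le (inf_le_left.trans hX.dom_le) hTX'
      have hle : Nat.card ↥(X ⊓ normalizerIn S Q) ≤ Nat.card S :=
        card_le_of_le_of_le le_rfl (inf_le_left.trans hX.dom_le)
      obtain ⟨V', -, hV'⟩ := hX.restrict (inf_le_left : X ⊓ normalizerIn S Q ≤ X)
      obtain ⟨M', -, hM'⟩ := hψ.restrict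
        (hV'.le_normalizerIn haQ' (hQT.trans hTX'.le) (inf_le_right.trans inf_le_right))
      have hcT : Nat.card T = Nat.card R := ha.card_eq.trans hg.card_eq.symm
      refine (ih _ (by omega) _ _ (ψ ∘ a') (by omega) (hQT.trans hTX'.le) inf_le_right
        (hM'.comp hV') (hψQ.comp haQ') rfl).congr fun x hx => ?_
      rw [Function.comp_apply, Function.comp_apply, ha' x hx]
  obtain ⟨k', hk', hkQ', hkk, -⟩ := hk.symm_pair hkQ hQR
  have hQR' : Q ≤ R' := fun y hy => by
    obtain ⟨x, hx, rfl⟩ := hkQ.surj hy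
    exact hk.mem (hQR hx)
  refine (key R' (g ∘ k') hQR' (hk.le_normalizerIn hkQ hQR (hR.trans inf_le_right))
    (hg.comp hk') (hgQ.comp hkQ')).of_comp_eq (key R g hQR hR hg hgQ) (fun x hx => hkQ.mem hx)
    fun x hx => ?_
  simp only [Function.comp_apply]
  rw [hkk x (hQR hx)]

/-- For a last link `g` starting at `B`, insert an arrow `χ` from `B` to `Q`: `ψ ∘ g ∘ f = (ψ ∘ g ∘
χ⁻¹) ∘ (χ ∘ f)`. The right factor is handled by induction. The left one is defined on a subgroup
larger than `Q`, since `g` extends beyond `B`. -/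
theorem ExtChain.extendsToCentralizer (hS : IsPGroup p S) (hQ : Q ≤ S)
    (hsat : ∀ R ≤ S, Nat.card Q < Nat.card R → F.SaturatedAt p R)
    (htop : ∀ P f, F.IsoOn Q P f → F.NormalizerArrow P Q) (h : F.ExtChain Q P f) :
    ∀ ψ M, F.IsoOn (normalizerIn S P) M ψ → F.IsoOn P Q ψ →
      F.ExtendsToCentralizer Q (ψ ∘ f) := by
  induction h with
  | refl f hf =>
    intro ψ M hψ hψQ
    refine (hψ.extendsToCentralizer hψQ (le_normalizerIn hQ) centralizerIn_le_normalizerIn).congr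
      fun x hx => ?_
    rw [Function.comp_apply, hf x hx]
  | step B D f g h hf hg X hX hgX hh ih =>
    intro ψ M hψ hψQ
    have hfi := hf.isoOn hQ
    obtain ⟨χ, N, hχ, hχQ⟩ := htop B f hfi
    obtain ⟨V, hgV⟩ := hgX
    have hBX : B < X ⊓ normalizerIn S B := by
      obtain ⟨y, hy, hn, hyQ⟩ := exists_mem_normalizerIn_notMem hS hgV.dom_le hX
      exact lt_of_le_of_ne (le_inf hX.le (le_normalizerIn hg.dom_le)) fun he =>
        hyQ (he ▸ ⟨hy, hn⟩)
    have hcX : Nat.card B < Nat.card ↥(X ⊓ normalizerIn S B) :=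
      card_lt_of_lt_of_le (inf_le_left.trans hgV.dom_le) hBX
    obtain ⟨W, -, hgW⟩ := hgV.restrict (inf_le_left : X ⊓ normalizerIn S B ≤ X)
    obtain ⟨M', -, hM'⟩ := hψ.restrict
      (hgW.le_normalizerIn hg hBX.le (inf_le_right.trans inf_le_right))
    obtain ⟨N', -, hN'⟩ := hχ.restrict (inf_le_right : X ⊓ normalizerIn S B ≤ _)
    obtain ⟨χ', hχ', hχQ', hχχ, -⟩ := hN'.symm_pair hχQ hBX.le
    have hQN : Q ≤ N' := fun y hy => by
      obtain ⟨x, hx, rfl⟩ := hχQ.surj hy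
      exact hN'.mem (hBX.le hx)
    have hE := extendsToCentralizer_of_isoOn hS hsat htop N' M' (ψ ∘ g ∘ χ')
      (by rw [← hN'.card_eq, hfi.card_eq]; exact hcX) hQN
      (hN'.le_normalizerIn hχQ hBX.le (inf_le_right.trans inf_le_right))
      (hM'.comp (hgW.comp hχ')) (hψQ.comp (hg.comp hχQ'))
    refine (hE.comp (ih χ N hχ hχQ) fun x hx => hχQ.mem (hfi.mem hx)).congr fun x hx => ?_
    simp only [Function.comp_apply]
    rw [hχχ _ (hBX.le (hfi.mem hx)), hh x hx]

/-- Write `f = σ ∘ ψ` on `P`, where `ψ` is defined on `N_S(P)` and `σ` is an automorphism of `Q`.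
Extend `σ` to `U`, then to `N_σ` without changing it on `Q`; this is possible because `N_S(Q)`
normalizes `U = Q C_S(Q)`. -/
theorem receptive_of_goodPair (hS : IsPGroup p S) {U : Subgroup G} {hU : U ≤ S}
    (hgood : F.GoodPair p hU Q)
    (hUQ : U = Q ⊔ centralizerIn S Q)
    (htop : ∀ P f, F.IsoOn Q P f → F.NormalizerArrow P Q)
    (hext : ∀ f, F.IsoOn Q Q f → F.ExtendsToCentralizer Q f) : F.Receptive Q := by
  have hNU : normalizerIn S Q ≤ Subgroup.normalizer (U : Set G) := by
    rw [hUQ]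
    exact normalizerIn_le_normalizer_sup
  intro P f hf
  obtain ⟨f', hf', -, -⟩ := hf.symm
  obtain ⟨ψ, M, hψ, hψQ⟩ := htop P f' hf'
  have hPN := le_normalizerIn hf.dom_le
  obtain ⟨ψ', hψ', hψQ', hψψ, hψψ'⟩ := hψ.symm_pair hψQ hPN
  have hσ := hf.comp hψQ'
  obtain ⟨σ, hσU, hσQ⟩ := hext _ hσ
  rw [← hUQ] at hσU
  obtain ⟨α, hα, hαf⟩ := id hσ
  have hY : ∀ g, g ∈ extensionControl S α ↔ _ := fun g => mem_extensionControl_iff hαf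
  obtain ⟨X, a, ⟨V, hX⟩, -, hYX, -, ha⟩ := hgood.exists_extension_eqOn hS hσU
    (hσ.congr hσQ) hgood.1 (Y := extensionControl S α) (fun y hy => ((hY y).1 hy).1)
    (fun y hy => hNU ⟨((hY y).1 hy).1, ((hY y).1 hy).2.1⟩) (fun y hy => ((hY y).1 hy).2.1)
    (fun y hy => by
      obtain ⟨h1, h2, t, ht, h⟩ := (hY y).1 hy
      refine ⟨t, ht, hNU ⟨ht, mem_normalizer_of_isoOn hσ h2 h⟩, fun x hx => ?_⟩
      rw [hσQ _ ((Subgroup.mem_normalizer_iff.1 h2 x).1 hx), hσQ x hx, h x hx])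
  obtain ⟨X', -, hX'⟩ := hψ'.restrict (inf_le_left : M ⊓ X ≤ M)
  have hX'ψ : F.IsoOn X' (M ⊓ X) ψ := by
    obtain ⟨i, hi, h1, h2⟩ := hX'.symm
    refine hi.congr fun x hx => ?_
    obtain ⟨y, hy, rfl⟩ := hX'.surj hx
    rw [h1 y hy, hψψ' y hy.1]
  obtain ⟨V', -, hV'⟩ := hX.restrict (inf_le_right : M ⊓ X ≤ X)
  refine ⟨X', a ∘ ψ, ⟨V', hV'.comp hX'ψ⟩, fun x hx => ?_, fun g hg hgP ⟨t, ht, h⟩ => ?_⟩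
  · rw [Function.comp_apply, ha _ (hψQ.mem hx), hσQ _ (hψQ.mem hx), Function.comp_apply,
      hψψ x (hPN hx)]
  · have hgN : g ∈ normalizerIn S P := ⟨hg, hgP⟩
    have hψg := hψ.le_normalizerIn hψQ hPN inf_le_right (hψ.mem hgN)
    -- `ψ` maps `N_f` into `N_σ`.
    have hmem : ψ g ∈ extensionControl S α := by
      refine (hY _).2 ⟨hψg.1, hψg.2, t, ht, fun y hy => ?_⟩
      obtain ⟨x, hx, rfl⟩ := hψQ.surj hy
      rw [← hψ.map_conj hgN (hPN hx), Function.comp_apply, Function.comp_apply,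
        hψψ _ (hPN ((Subgroup.mem_normalizer_iff.1 hgP x).1 hx)), hψψ _ (hPN hx), h x hx]
    rw [← hψψ g hgN]
    exact hX'.mem ⟨hψ.mem hgN, hYX hmem⟩

/-- A conjugacy class of subgroups `P` with `C_S(P) ≰ P` in which isomorphisms are composites of
isomorphisms that extend to larger subgroups has a fully automized and receptive member, provided
this is so for all larger subgroups. -/
theorem saturatedAt_of_not_centric (hS : IsPGroup p S) (hP : P ≤ S)
    (hsat : ∀ R ≤ S, Nat.card P < Nat.card R → F.SaturatedAt p R)
    (hgen : ∀ A B f g, F.IsoOn P A f → F.IsoOn A B g → F.ExtChain A B g)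
    (hnc : ∀ A f, F.IsoOn P A f → ¬ centralizerIn S A ≤ A) : F.SaturatedAt p P := by
  obtain ⟨Q₁, f₁, hf₁, htop₁⟩ := exists_normalizerArrow_target hS hP hsat hgen
  have hQ₁ := hf₁.cod_le
  have hU₁S : Q₁ ⊔ centralizerIn S Q₁ ≤ S := (sup_centralizerIn_le hQ₁).trans inf_le_left
  have hlt : Nat.card P < Nat.card ↥(Q₁ ⊔ centralizerIn S Q₁) := by
    rw [hf₁.card_eq]
    exact card_lt_of_lt_of_le hU₁S (lt_of_le_of_ne le_sup_left fun he =>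
      hnc _ _ hf₁ (le_sup_right.trans he.ge))
  obtain ⟨U, Q, hU, g, hg, hgQ, hgood⟩ := exists_goodPair hS (hsat _ hU₁S hlt)
    (le_sup_left : Q₁ ≤ Q₁ ⊔ centralizerIn S Q₁)
  obtain ⟨X, g', ⟨V, hX⟩, -, hNX, hgU', hgQ'⟩ :=
    hgood.exists_extension_normalizer hS hg hgQ le_sup_left
  have hQ₁N := le_normalizerIn hQ₁
  obtain ⟨N, -, hN⟩ := hX.restrict
    ((le_inf (le_inf inf_le_left (normalizerIn_le_normalizer_sup)) le_rfl).trans hNX)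
  have harrow : F.NormalizerArrow Q₁ Q := ⟨g', N, hN, hgQ'⟩
  -- `Q` is conjugate to `Q₁`, so `N_S(Q)` maps into `N_S(Q₁)` and cannot be larger. Hence `Q` is
  -- again a target for all normalizers.
  obtain rfl : N = normalizerIn S Q := eq_of_le_of_card_le inf_le_left
    (hN.le_normalizerIn hgQ' hQ₁N inf_le_right)
    (by rw [← hN.card_eq]; exact (htop₁ _ _ (hgQ'.comp hf₁)).card_le)
  have hQ := hgQ.cod_le
  have htop : ∀ A f, F.IsoOn Q A f → F.NormalizerArrow A Q := fun A f hf =>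
    (htop₁ A _ (hf.comp (hgQ'.comp hf₁))).trans harrow
  have hUQ : U = Q ⊔ centralizerIn S Q := by
    apply le_antisymm
    · intro y hy
      obtain ⟨x, hx, rfl⟩ := hgU'.surj hy
      exact hN.map_sup_mem hQ₁N centralizerIn_le_normalizerIn
        (fun x hx => le_sup_left (a := Q) (hgQ'.mem hx))
        (fun x hx => le_sup_right (a := Q) (hN.map_centralizerIn hgQ' hQ₁N
          (centralizerIn_le_normalizerIn hx) hx)) x hx
    · refine sup_le hgood.1 fun y hy => ?_
      obtain ⟨i, hi, hiQ, -, hi'⟩ := hN.symm_pair hgQ' hQ₁N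
      have hyN := centralizerIn_le_normalizerIn hy
      rw [← hi' y hyN]
      exact hgU'.mem (le_sup_right (a := Q₁)
        (hi.map_centralizerIn hiQ (le_normalizerIn hQ) hyN hy))
  have hext : ∀ f, F.IsoOn Q Q f → F.ExtendsToCentralizer Q f := fun f hf =>
    (hgen Q Q _ f (hgQ'.comp hf₁) hf).extendsToCentralizer hS hQ
      (by rwa [← (hgQ'.comp hf₁).card_eq]) htop id _ (IsoOn.refl inf_le_left) (IsoOn.refl hQ)
  exact ⟨Q, hQ, _, hgQ'.comp hf₁, automized_of_goodPair hgood hUQ hQ hext,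
    receptive_of_goodPair hS hgood hUQ htop hext⟩

end FusionSystem

/-! ### Restrictions of elements of a given automorphism group. -/

section StepVia

variable {G : Type*} [Group G] {B P Q R : Subgroup G} {D : Subgroup (MulAut B)} {f g : G → G}

/-- On `P ≤ B`, the function `f` agrees with an automorphism of `B` in `D`, and `f(P) = Q`. -/
def StepVia (D : Subgroup (MulAut B)) (P Q : Subgroup G) (f : G → G) : Prop :=
  P ≤ B ∧ (∃ k ∈ D, ∀ x : B, (x : G) ∈ P → f x = k x) ∧ ∀ y, y ∈ Q ↔ ∃ x ∈ P, f x = y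

namespace StepVia

theorem mem (h : StepVia D P Q f) {x : G} (hx : x ∈ P) : f x ∈ Q := (h.2.2 _).2 ⟨x, hx, rfl⟩

theorem cod_le (h : StepVia D P Q f) : Q ≤ B := by
  intro y hy
  obtain ⟨hP, ⟨k, -, hk⟩, hQ⟩ := h
  obtain ⟨x, hx, rfl⟩ := (hQ y).1 hy
  rw [hk ⟨x, hP hx⟩ hx]
  exact (k _).2

theorem congr (h : StepVia D P Q f) (hfg : ∀ x ∈ P, g x = f x) : StepVia D P Q g := by
  obtain ⟨hP, ⟨k, hk, h⟩, hQ⟩ := h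
  refine ⟨hP, ⟨k, hk, fun x hx => by rw [hfg x hx, h x hx]⟩, fun y => ?_⟩
  rw [hQ]
  exact exists_congr fun x => and_congr_right fun hx => by rw [hfg x hx]

theorem refl (hP : P ≤ B) : StepVia D P P id :=
  ⟨hP, ⟨1, D.one_mem, fun x _ => by simp⟩, fun y => by simp⟩

theorem comp (hg : StepVia D Q R g) (hf : StepVia D P Q f) : StepVia D P R (g ∘ f) := by
  obtain ⟨hP, ⟨k, hk, h⟩, hQ⟩ := id hf
  obtain ⟨hQB, ⟨l, hl, h'⟩, hR⟩ := hg
  refine ⟨hP, ⟨l * k, D.mul_mem hl hk, fun x hx => ?_⟩, fun y => ?_⟩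
  · rw [Function.comp_apply, MulAut.mul_apply, h x hx, h' (k x) (by rw [← h x hx]; exact hf.mem hx)]
  · rw [hR]
    constructor
    · rintro ⟨z, hz, rfl⟩
      obtain ⟨x, hx, rfl⟩ := (hQ z).1 hz
      exact ⟨x, hx, rfl⟩
    · rintro ⟨x, hx, rfl⟩
      exact ⟨f x, hf.mem hx, rfl⟩

theorem symm (h : StepVia D P Q f) :
    ∃ g, StepVia D Q P g ∧ (∀ x ∈ P, g (f x) = x) ∧ ∀ y ∈ Q, f (g y) = y := by
  have hQB := h.cod_le
  obtain ⟨hP, ⟨k, hk, h⟩, hQ⟩ := h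
  have h1 : ∀ x ∈ P, extendFun (fun x => (k⁻¹ x : G)) (f x) = x := fun x hx => by
    rw [h ⟨x, hP hx⟩ hx, extendFun_apply, MulAut.inv_apply_self]
  refine ⟨extendFun fun x => (k⁻¹ x : G), ⟨hQB, ⟨k⁻¹, D.inv_mem hk, fun x _ => ?_⟩, fun y => ?_⟩,
    h1, fun y hy => ?_⟩
  · rw [extendFun_apply]
  · constructor
    · intro hy
      exact ⟨f y, (hQ _).2 ⟨y, hy, rfl⟩, h1 y hy⟩
    · rintro ⟨x, hx, rfl⟩
      obtain ⟨z, hz, rfl⟩ := (hQ x).1 hx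
      rwa [h1 z hz]
  · obtain ⟨z, hz, rfl⟩ := (hQ y).1 hy
    rw [h1 z hz]

theorem restrict (h : StepVia D P Q f) {P' : Subgroup G} (hP' : P' ≤ P) :
    ∃ Q' ≤ Q, StepVia D P' Q' f := by
  obtain ⟨hP, ⟨k, hk, h⟩, hQ⟩ := h
  refine ⟨((P'.subgroupOf B).map k.toMonoidHom).map B.subtype, ?_, hP'.trans hP,
    ⟨k, hk, fun x hx => h x (hP' hx)⟩, fun y => ?_⟩
  · rintro _ ⟨_, ⟨x, hx, rfl⟩, rfl⟩
    exact (hQ _).2 ⟨x, hP' hx, h x (hP' hx)⟩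
  · constructor
    · rintro ⟨_, ⟨x, hx, rfl⟩, rfl⟩
      exact ⟨x, hx, h x (hP' hx)⟩
    · rintro ⟨x, hx, rfl⟩
      exact ⟨_, ⟨⟨x, hP (hP' hx)⟩, hx, rfl⟩, (h ⟨x, hP (hP' hx)⟩ (hP' hx)).symm⟩

theorem map_mul (h : StepVia D P Q f) {x y : G} (hx : x ∈ P) (hy : y ∈ P) :
    f (x * y) = f x * f y := by
  obtain ⟨hP, ⟨k, -, h⟩, -⟩ := h
  have := h (⟨x, hP hx⟩ * ⟨y, hP hy⟩) (P.mul_mem hx hy)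
  rw [_root_.map_mul, Subgroup.coe_mul, Subgroup.coe_mul, ← h _ hx, ← h _ hy] at this
  exact this

theorem of_mem {k : MulAut B} (hk : k ∈ D) : StepVia D B B (extendFun fun x => (k x : G)) := by
  refine ⟨le_rfl, ⟨k, hk, fun x _ => extendFun_apply _ x⟩, fun y => ⟨fun hy =>
    ⟨(k⁻¹ ⟨y, hy⟩ : B), (k⁻¹ _).2, ?_⟩, ?_⟩⟩
  · rw [extendFun_apply, MulAut.apply_inv_self]
  · rintro ⟨x, hx, rfl⟩
    rw [extendFun_apply (P := B) _ ⟨x, hx⟩]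
    exact (k _).2

theorem mem_of_self {β : MulAut B} (h : StepVia D B B (extendFun fun x => (β x : G))) : β ∈ D := by
  obtain ⟨-, ⟨k, hk, h⟩, -⟩ := h
  have : β = k := MulEquiv.ext fun x => Subtype.ext (by rw [← h x x.2, extendFun_apply])
  rwa [this]

theorem isoOn {S : Subgroup G} {F : FusionSystem S} {hB : B ≤ S} (hD : D ≤ F.autF hB)
    (h : StepVia D P Q f) : F.IsoOn P Q f := by
  obtain ⟨hP, ⟨k, hk, h⟩, hQ⟩ := h
  have he : ∀ x ∈ P, f x = extendFun (fun x => (k x : G)) x := fun x hx => by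
    rw [h ⟨x, hP hx⟩ hx, extendFun_apply (P := B) _ ⟨x, hP hx⟩]
  refine ((FusionSystem.mem_autF_iff.1 (hD hk)).restrict_of_iff hP (fun x hx => ?_)
    fun y hy => ?_).congr he
  · rw [← he x hx]
    exact (hQ _).2 ⟨x, hx, rfl⟩
  · obtain ⟨x, hx, rfl⟩ := (hQ y).1 hy
    exact ⟨x, hx, (he x hx).symm⟩

theorem exists_extension (h : StepVia D P Q f) : ∃ k, StepVia D B B k ∧ ∀ x ∈ P, k x = f x := by
  obtain ⟨hP, ⟨k, hk, h⟩, -⟩ := h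
  exact ⟨_, of_mem hk, fun x hx => by
    rw [h ⟨x, hP hx⟩ hx, extendFun_apply (P := B) _ ⟨x, hP hx⟩]⟩

end StepVia

end StepVia

/-! ### Morphisms of a generated system as composites of restrictions. -/

section GeneratedBy

variable {G : Type*} [Group G] {T E P Q R : Subgroup G} {K : Subgroup (MulAut T)}
  {D : Subgroup (MulAut E)} {f g : G → G}

/-- Composites of restrictions of automorphisms in `K` and `D`. -/
inductive StepChain (K : Subgroup (MulAut T)) (D : Subgroup (MulAut E)) (P : Subgroup G) :
    Subgroup G → (G → G) → Prop
  | refl (f : G → G) (hf : ∀ x ∈ P, f x = x) : StepChain K D P P f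
  | step (Q R : Subgroup G) (f g h : G → G) (hf : StepChain K D P Q f)
      (hg : StepVia K Q R g ∨ StepVia D Q R g) (hh : ∀ x ∈ P, h x = g (f x)) : StepChain K D P R h

namespace StepChain

theorem congr (h : StepChain K D P Q f) (hfg : ∀ x ∈ P, g x = f x) : StepChain K D P Q g := by
  cases h with
  | refl f hf => exact refl g fun x hx => (hfg x hx).trans (hf x hx)
  | step Q R f g h hf hg hh => exact step Q _ f g _ hf hg fun x hx => (hfg x hx).trans (hh x hx)

theorem mem (h : StepChain K D P Q f) {x : G} (hx : x ∈ P) : f x ∈ Q := by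
  induction h with
  | refl f hf => rwa [hf x hx]
  | step Q R f g h hf hg hh ih =>
    rw [hh x hx]
    exact hg.elim (fun h => h.mem ih) fun h => h.mem ih

theorem map_mul (h : StepChain K D P Q f) {x y : G} (hx : x ∈ P) (hy : y ∈ P) :
    f (x * y) = f x * f y := by
  induction h with
  | refl f hf => rw [hf _ hx, hf _ hy, hf _ (P.mul_mem hx hy)]
  | step Q R f g h hf hg hh ih =>
    rw [hh _ hx, hh _ hy, hh _ (P.mul_mem hx hy), ih]
    exact hg.elim (fun h => h.map_mul (hf.mem hx) (hf.mem hy))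
      fun h => h.map_mul (hf.mem hx) (hf.mem hy)

theorem trans (hg : StepChain K D Q R g) (hf : StepChain K D P Q f) :
    StepChain K D P R (g ∘ f) := by
  induction hg with
  | refl g hg => exact hf.congr fun x hx => hg _ (hf.mem hx)
  | step A C a b c ha hb hc ih =>
    exact step _ _ _ b _ ih hb fun x hx => hc _ (hf.mem hx)

theorem single (h : StepVia K P Q f ∨ StepVia D P Q f) : StepChain K D P Q f :=
  step P Q id f f (refl _ fun _ _ => rfl) h fun _ _ => rfl

theorem symm (h : StepChain K D P Q f) :
    ∃ g, StepChain K D Q P g ∧ (∀ x ∈ P, g (f x) = x) ∧ ∀ y ∈ Q, f (g y) = y := by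
  induction h with
  | refl f hf => exact ⟨id, refl _ fun _ _ => rfl, hf, hf⟩
  | step Q R f g h hf hg hh ih =>
    obtain ⟨f', hf', h1, h2⟩ := ih
    obtain ⟨g', hg', h3, h4⟩ : ∃ g', (StepVia K R Q g' ∨ StepVia D R Q g') ∧
        (∀ x ∈ Q, g' (g x) = x) ∧ ∀ y ∈ R, g (g' y) = y := by
      rcases hg with hg | hg
      · obtain ⟨g', hg', h⟩ := hg.symm
        exact ⟨g', Or.inl hg', h⟩
      · obtain ⟨g', hg', h⟩ := hg.symm
        exact ⟨g', Or.inr hg', h⟩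
    have hg's := single hg'
    refine ⟨f' ∘ g', hf'.trans hg's, fun x hx => ?_, fun y hy => ?_⟩
    · rw [Function.comp_apply, hh x hx, h3 _ (hf.mem hx), h1 x hx]
    · rw [Function.comp_apply, hh _ (hf'.mem (hg's.mem hy)), h2 _ (hg's.mem hy), h4 y hy]

theorem restrict (h : StepChain K D P Q f) {P' : Subgroup G} (hP' : P' ≤ P) :
    ∃ Q' ≤ Q, StepChain K D P' Q' f := by
  induction h with
  | refl f hf => exact ⟨P', hP', refl f fun x hx => hf x (hP' hx)⟩
  | step Q R f g h hf hg hh ih =>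
    obtain ⟨Q', hQ', hf'⟩ := ih
    obtain ⟨R', hR', hg'⟩ : ∃ R' ≤ R, StepVia K Q' R' g ∨ StepVia D Q' R' g := by
      rcases hg with hg | hg
      · obtain ⟨R', hR', hg'⟩ := hg.restrict hQ'
        exact ⟨R', hR', Or.inl hg'⟩
      · obtain ⟨R', hR', hg'⟩ := hg.restrict hQ'
        exact ⟨R', hR', Or.inr hg'⟩
    exact ⟨R', hR', step _ _ f g h hf' hg' fun x hx => hh x (hP' hx)⟩

end StepChain

theorem stepVia_conj (hK : innerAut T ≤ K) {t : G} (ht : t ∈ T) :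
    StepVia K T T (fun x => t * x * t⁻¹) :=
  (StepVia.of_mem (hK ⟨⟨t, ht⟩, rfl⟩)).congr fun x hx => by
    rw [extendFun_apply (P := T) _ ⟨x, hx⟩]
    rfl

/-- The fusion system whose morphisms are composites of restrictions of elements of `K` and `D`. -/
def stepSystem (hK : innerAut T ≤ K) (D : Subgroup (MulAut E)) : FusionSystem T where
  Hom P Q := {φ | P ≤ T ∧ Q ≤ T ∧ ∃ R ≤ Q, ∃ f, StepChain K D P R f ∧ ∀ x : P, (φ x : G) = f x}
  dom_le h := h.1
  cod_le h := h.2.1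
  injective := by
    rintro P Q φ ⟨-, -, R, -, f, hf, hφ⟩ x y hxy
    obtain ⟨g, -, hg, -⟩ := hf.symm
    have : f x = f y := by rw [← hφ, ← hφ, hxy]
    exact Subtype.ext (by rw [← hg x x.2, this, hg y y.2])
  conj_mem := by
    rintro P Q φ hP hQ ⟨t, ht, h⟩
    obtain ⟨R, hR, hs⟩ := (stepVia_conj hK ht).restrict hP
    refine ⟨hP, hQ, R, fun y hy => ?_, _, StepChain.single (Or.inl hs), h⟩
    obtain ⟨x, hx, rfl⟩ := (hs.2.2 y).1 hy
    change t * x * t⁻¹ ∈ Q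
    rw [← h ⟨x, hx⟩]
    exact (φ ⟨x, hx⟩).2
  comp_mem := by
    rintro P Q R ψ φ ⟨-, hR, A, hA, a, ha, hψ⟩ ⟨hP, -, B, hB, b, hb, hφ⟩
    obtain ⟨C, hC, hc⟩ := ha.restrict hB
    refine ⟨hP, hR, C, hC.trans hA, _, hc.trans hb, fun x => ?_⟩
    rw [MonoidHom.comp_apply, hψ, hφ, Function.comp_apply]
  factor := by
    rintro P Q φ ⟨hP, hQ, R, hR, f, hf, hφ⟩
    obtain ⟨g, hg, hgf, hfg⟩ := hf.symm
    let e : P ≃* R :=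
      { toFun := fun x => ⟨f x, hf.mem x.2⟩
        invFun := fun y => ⟨g y, hg.mem y.2⟩
        left_inv := fun x => Subtype.ext (hgf x x.2)
        right_inv := fun y => Subtype.ext (hfg y y.2)
        map_mul' := fun x y => Subtype.ext (hf.map_mul x.2 y.2) }
    exact ⟨R, hR, e, ⟨hP, hR.trans hQ, R, le_rfl, f, hf, fun x => rfl⟩,
      ⟨hR.trans hQ, hP, P, le_rfl, g, hg, fun x => rfl⟩,
      MonoidHom.ext fun x => Subtype.ext (hφ x)⟩

/-- The fusion system on `T` generated by `K ≤ Aut(T)` and `D ≤ Aut(E)`. -/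
abbrev pairSystem (K : Subgroup (MulAut T)) (D : Subgroup (MulAut E)) : FusionSystem T :=
  FusionSystem.generate T (autMorphisms K ∪ autMorphisms D)

theorem le_autF_pairSystem_left : K ≤ (pairSystem K D).autF le_rfl := fun k hk =>
  ⟨le_rfl, le_rfl, k.injective, fun _ hF => hF ⟨T, T, k.toMonoidHom⟩ (Or.inl ⟨k, hk, rfl⟩)⟩

theorem le_autF_pairSystem_right (hE : E ≤ T) : D ≤ (pairSystem K D).autF hE := fun k hk =>
  ⟨hE, hE, k.injective, fun _ hF => hF ⟨E, E, k.toMonoidHom⟩ (Or.inr ⟨k, hk, rfl⟩)⟩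

/-- The composites of restrictions already form a fusion system containing the generators, so the
generated system lies inside it. -/
theorem stepChain_of_isoOn (hK : innerAut T ≤ K) (hE : E ≤ T)
    (h : (pairSystem K D).IsoOn P Q f) : StepChain K D P Q f := by
  obtain ⟨α, hα, ha⟩ := h
  have hc : (stepSystem hK D).Contains (autMorphisms K ∪ autMorphisms D) := by
    rintro _ (⟨k, hk, rfl⟩ | ⟨k, hk, rfl⟩)
    · exact ⟨le_rfl, le_rfl, T, le_rfl, _, StepChain.single (Or.inl (StepVia.of_mem hk)),
        fun x => (extendFun_apply (fun x => (k x : G)) x).symm⟩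
    · exact ⟨hE, hE, E, le_rfl, _, StepChain.single (Or.inr (StepVia.of_mem hk)),
        fun x => (extendFun_apply (fun x => (k x : G)) x).symm⟩
  obtain ⟨-, -, R, hR, g, hg, hαg⟩ := hα.2.2.2 _ hc
  have hRQ : R = Q := by
    refine le_antisymm hR fun y hy => ?_
    obtain ⟨x, hx⟩ := α.surjective ⟨y, hy⟩
    have h1 := hαg x
    change (α x : G) = g x at h1
    rw [hx] at h1
    change y = g x at h1
    rw [h1]
    exact hg.mem x.2
  subst hRQ
  exact hg.congr fun x hx => by
    rw [← ha ⟨x, hx⟩]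
    exact hαg ⟨x, hx⟩

end GeneratedBy

/-! ### The saturation criterion for the system generated by `K` and `D`. -/

section PairSystem

variable {G : Type*} [Group G] {T E P Q R : Subgroup G} {K : Subgroup (MulAut T)}
  {D : Subgroup (MulAut E)} {f g : G → G} {p : ℕ}

namespace StepChain

/-- A step in `D` would require an intermediate group inside `E`, which is excluded, so only steps
in `K` occur. -/
theorem stepVia_left (hP : P ≤ T) (hE : ∀ P₁ f, P₁ ≤ E → ¬ StepVia K P P₁ f)
    (h : StepChain K D P Q f) : StepVia K P Q f := by
  induction h with
  | refl f hf => exact (StepVia.refl hP).congr hf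
  | step Q R f g h hf hg hh ih =>
    rcases hg with hg | hg
    · exact (hg.comp ih).congr hh
    · exact absurd ih (hE Q f hg.1)

/-- By orders, a step in `D` can only start at `E` itself. The preceding steps in `K` then carry `E`
to `E` and are absorbed into `D`. -/
theorem exists_stepVia_comp [Finite T] (hE : E ≤ T)
    (hKD : ∀ f, StepVia K E E f → StepVia D E E f) (h : StepChain K D E Q f) :
    ∃ a b, StepVia D E E a ∧ StepVia K E Q b ∧ ∀ x ∈ E, f x = b (a x) := by
  induction h with
  | refl f hf => exact ⟨id, id, StepVia.refl le_rfl, StepVia.refl hE, hf⟩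
  | step Q R f g h hf hg hh ih =>
    obtain ⟨a, b, ha, hb, hfab⟩ := ih
    rcases hg with hg | hg
    · exact ⟨a, _, ha, hg.comp hb, fun x hx => by rw [hh x hx, hfab x hx, Function.comp_apply]⟩
    · have hK : K ≤ (pairSystem K D).autF le_rfl := le_autF_pairSystem_left
      have hD : D ≤ (pairSystem K D).autF hE := le_autF_pairSystem_right hE
      obtain rfl : Q = E := eq_of_le_of_card_le hE hg.1 (hb.isoOn hK).card_eq.le
      obtain rfl : R = Q := eq_of_le_of_card_le hE hg.cod_le (hg.isoOn hD).card_eq.le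
      refine ⟨_, id, hg.comp ((hKD b hb).comp ha), StepVia.refl hE, fun x hx => ?_⟩
      rw [hh x hx, hfab x hx]
      rfl

theorem exists_stepVia_lt [Finite T] (hE : E ≤ T) (hP : ∃ P₁ < E, ∃ a, StepVia K P P₁ a)
    (h : StepChain K D P Q f) : ∃ Q₁ < E, ∃ a, StepVia K Q Q₁ a := by
  have hK : K ≤ (pairSystem K D).autF le_rfl := le_autF_pairSystem_left
  have hD : D ≤ (pairSystem K D).autF hE := le_autF_pairSystem_right hE
  induction h with
  | refl f hf => exact hP
  | step Q R f g h hf hg hh ih =>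
    obtain ⟨Q₁, hQ₁, a, ha⟩ := ih
    rcases hg with hg | hg
    · obtain ⟨g', hg', -, -⟩ := hg.symm
      exact ⟨Q₁, hQ₁, _, ha.comp hg'⟩
    · have h1 := card_lt_of_lt_of_le hE hQ₁
      rw [← (ha.isoOn hK).card_eq, (hg.isoOn hD).card_eq] at h1
      exact ⟨R, lt_of_le_of_ne hg.cod_le fun he => by subst he; exact lt_irrefl _ h1, id,
        StepVia.refl (hg.cod_le.trans hE)⟩

/-- Steps extend to `T` or to `E`, both larger than `P`. This provides the generation hypothesis of
`FusionSystem.saturatedAt_of_not_centric`. -/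
theorem extChain [Finite T] (hE : E ≤ T) (hP : P ≤ T) (hc : Nat.card P < Nat.card E)
    (h : StepChain K D P Q f) : (pairSystem K D).ExtChain P Q f := by
  have hK : K ≤ (pairSystem K D).autF le_rfl := le_autF_pairSystem_left
  have hD : D ≤ (pairSystem K D).autF hE := le_autF_pairSystem_right hE
  have hcT := card_le_of_le_of_le le_rfl hE
  induction h with
  | refl f hf => exact .refl f hf
  | step Q R f g h hf hg hh ih =>
    have hfi := ih.isoOn hP
    have hcQ := hfi.card_eq
    rcases hg with hg | hg
    · obtain ⟨k, hk, hkg⟩ := hg.exists_extension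
      refine .step Q R f k h ih ((hg.isoOn hK).congr hkg) T (lt_of_le_of_ne hg.1 fun he => ?_)
        (hk.isoOn hK).morOn fun x hx => ?_
      · subst he
        omega
      · rw [hkg _ (hfi.mem hx), hh x hx]
    · obtain ⟨k, hk, hkg⟩ := hg.exists_extension
      refine .step Q R f k h ih ((hg.isoOn hD).congr hkg) E (lt_of_le_of_ne hg.1 fun he => ?_)
        (hk.isoOn hD).morOn fun x hx => ?_
      · subst he
        omega
      · rw [hkg _ (hfi.mem hx), hh x hx]

end StepChain

/-- All morphisms on `P` come from `K`, hence extend to `T`. As `Inn(T)` is normal, its index stays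
prime to `p` on the stabilizer of `P`, and restriction to `P` preserves this. -/
theorem saturatedAt_pairSystem_of_not_le (hK : innerAut T ≤ K)
    (hKi : ¬ p ∣ (innerAut T).relIndex K) (hE : E ≤ T) (hP : P ≤ T)
    (hPE : ∀ P₁ f, P₁ ≤ E → ¬ StepVia K P P₁ f) : (pairSystem K D).SaturatedAt p P := by
  have hKF : K ≤ (pairSystem K D).autF le_rfl := le_autF_pairSystem_left
  have hstep : ∀ Q f, (pairSystem K D).IsoOn P Q f → StepVia K P Q f := fun Q f h =>
    (stepChain_of_isoOn hK hE h).stepVia_left hP hPE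
  refine ⟨P, hP, id, FusionSystem.IsoOn.refl hP, ?_, fun P' f hf => ?_⟩
  · refine not_dvd_relIndex_of_restrict hP (D := K) (D₀ := innerAut T) (fun h => hKi (h.trans ?_))
      (fun β hβ => ?_) (fun α hα β h => FusionSystem.mem_autF_of_restrict hP hP (hKF hα) h) ?_
    · have h1 : ((innerAut T).subgroupOf K).relIndex ((K ⊓ autStabilizer T P).subgroupOf K) ∣ _ :=
        Subgroup.relIndex_dvd_index_of_normal _ _
      rwa [Subgroup.relIndex_subgroupOf inf_le_left] at h1
    · obtain ⟨-, ⟨k, hk, h⟩, -⟩ := hstep P _ (FusionSystem.mem_autF_iff.1 hβ)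
      refine ⟨k, hk, fun x => ?_⟩
      rw [← h _ x.2, Subgroup.coe_inclusion, extendFun_apply]
    · rintro _ ⟨t, rfl⟩ β h
      exact ⟨t, t.2, fun x => (h x).symm⟩
  · obtain ⟨f', hf', -, hff'⟩ := hf.symm
    obtain ⟨f'', hf'', h1, -⟩ := (hstep _ _ hf').symm
    obtain ⟨k, hk, hkf⟩ := hf''.exists_extension
    refine ⟨T, k, (hk.isoOn hKF).morOn, fun x hx => ?_, fun g hg _ _ => hg⟩
    obtain ⟨y, hy, rfl⟩ := hf'.surj hx
    rw [hkf _ hx, h1 y hy, hff' y hy]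

theorem saturatedAt_pairSystem_self [Finite T] (hK : innerAut T ≤ K) (hE : E ≤ T)
    (hKD : ∀ f, StepVia K E E f → StepVia D E E f) (hDi : ¬ p ∣ (autConj T E).relIndex D)
    (hDK : ∀ f, StepVia D E E f → ∀ g ∈ T, g ∈ Subgroup.normalizer (E : Set G) → g ∉ E →
      (∃ t ∈ T, ∀ x ∈ E, f (g * x * g⁻¹) = t * f x * t⁻¹) → StepVia K E E f) :
    (pairSystem K D).SaturatedAt p E := by
  have hKF : K ≤ (pairSystem K D).autF le_rfl := le_autF_pairSystem_left
  have hDF : D ≤ (pairSystem K D).autF hE := le_autF_pairSystem_right hE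
  have hstep : ∀ Q f, (pairSystem K D).IsoOn E Q f →
      ∃ a b, StepVia D E E a ∧ StepVia K E Q b ∧ ∀ x ∈ E, f x = b (a x) := fun Q f h =>
    (stepChain_of_isoOn hK hE h).exists_stepVia_comp hE hKD
  refine ⟨E, hE, id, FusionSystem.IsoOn.refl hE, ?_, fun P f hf => ?_⟩
  · have : (pairSystem K D).autF hE = D := by
      refine le_antisymm (fun β hβ => ?_) hDF
      obtain ⟨a, b, ha, hb, h⟩ := hstep E _ (FusionSystem.mem_autF_iff.1 hβ)
      exact (((hKD b hb).comp ha).congr h).mem_of_self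
    rw [FusionSystem.Automized, this]
    exact hDi
  · obtain ⟨f', hf', -, hff'⟩ := hf.symm
    obtain ⟨a, b, ha, hb, hab⟩ := hstep P f' hf'
    obtain ⟨a', ha', haa, -⟩ := ha.symm
    obtain ⟨b', hb', hbb, -⟩ := hb.symm
    have hfab : ∀ x ∈ P, f x = a' (b' x) := fun x hx => by
      obtain ⟨y, hy, rfl⟩ := hf'.surj hx
      rw [hff' y hy, hab y hy, hbb _ (ha.mem hy), haa y hy]
    -- Here `f = a' ∘ b'` with `a'` in `D` and `b'` from `K`. If `a'` is induced by `K`, then `f`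
    -- extends to `T`. Otherwise `N_f = P`: an element of `N_f` outside `P`, carried by `b'` to
    -- `N_T(E)`, would force `a'` to be induced by `K`.
    by_cases hK' : StepVia K E E a'
    · obtain ⟨k, hk, hkf⟩ := (hK'.comp hb').exists_extension
      exact ⟨T, k, (hk.isoOn hKF).morOn, fun x hx => by rw [hkf x hx, hfab x hx]; rfl,
        fun g hg _ _ => hg⟩
    · refine ⟨P, f, hf.morOn, fun _ _ => rfl, fun g hg hgP ⟨t, ht, h⟩ => ?_⟩
      obtain ⟨k, hk, hkb⟩ := hb'.exists_extension
      have hki := hk.isoOn hKF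
      have hkP : (pairSystem K D).IsoOn P E k := (hb'.isoOn hKF).congr hkb
      have hP := hf.dom_le
      by_contra hgn
      have hn := hki.restrict (inf_le_left : normalizerIn T P ≤ T)
      obtain ⟨M, -, hM⟩ := hn
      have hgN : g ∈ normalizerIn T P := ⟨hg, hgP⟩
      have hkgN := hM.le_normalizerIn hkP (le_normalizerIn hP) inf_le_right (hM.mem hgN)
      refine hK' (hDK a' ha' (k g) hkgN.1 hkgN.2 (fun hkg => hgn
        ((hki.apply_mem_iff hkP hP hg).1 hkg)) ⟨t, ht, fun y hy => ?_⟩)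
      obtain ⟨x, hx, rfl⟩ := hkP.surj hy
      have hx' := (Subgroup.mem_normalizer_iff.1 hgP x).1 hx
      rw [← hki.map_conj hg (hP hx), hkb _ hx', hkb _ hx, ← hfab _ hx', ← hfab _ hx, h x hx]

/-- Let `K ≤ Aut(T)` contain `Inn(T)` with index prime to `p`, and let `D ≤ Aut(E)`, where `E ≤ T`.
If `D` contains the automorphisms of `E` induced by `K` and `Aut_T(E)` has index prime to `p` in
`D`, elements of `D` which conjugate some noninner element of `Aut_T(E)` into `Aut_T(E)` are induced
by `K`, and `C_T(P) ≰ P` for all `P < E`, then `K` and `D` generate a saturated fusion system. -/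
theorem isSaturated_pairSystem [Fact p.Prime] [Finite T] (hT : IsPGroup p T) (hK : innerAut T ≤ K)
    (hKi : ¬ p ∣ (innerAut T).relIndex K) (hE : E ≤ T)
    (hKD : ∀ f, StepVia K E E f → StepVia D E E f) (hDi : ¬ p ∣ (autConj T E).relIndex D)
    (hDK : ∀ f, StepVia D E E f → ∀ g ∈ T, g ∈ Subgroup.normalizer (E : Set G) → g ∉ E →
      (∃ t ∈ T, ∀ x ∈ E, f (g * x * g⁻¹) = t * f x * t⁻¹) → StepVia K E E f)
    (hmin : ∀ P < E, ¬ centralizerIn T P ≤ P) : (pairSystem K D).IsSaturated p := by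
  have hKF : K ≤ (pairSystem K D).autF le_rfl := le_autF_pairSystem_left
  rw [FusionSystem.isSaturated_iff hT]
  intro P hP
  induction hm : Nat.card T - Nat.card P using Nat.strong_induction_on generalizing P with
  | _ m ih =>
  by_cases hPE : ∀ P₁ f, P₁ ≤ E → ¬ StepVia K P P₁ f
  · exact saturatedAt_pairSystem_of_not_le hK hKi hE hP hPE
  · push Not at hPE
    obtain ⟨P₁, a, hP₁, ha⟩ := hPE
    rcases hP₁.eq_or_lt with rfl | hlt
    · exact (saturatedAt_pairSystem_self hK hE hKD hDi hDK).of_isoOn (ha.isoOn hKF)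
    · have hPlt : ∃ P₁ < E, ∃ a, StepVia K P P₁ a := ⟨P₁, hlt, a, ha⟩
      have hc : Nat.card P < Nat.card E := by
        rw [(ha.isoOn hKF).card_eq]
        exact card_lt_of_lt_of_le hE hlt
      refine FusionSystem.saturatedAt_of_not_centric hT hP (fun R hR hPR => ih _ ?_ R hR rfl)
        (fun A B f g hf hg => (stepChain_of_isoOn hK hE hg).extChain hE hf.cod_le
          (by rwa [← hf.card_eq])) fun A f hf hA => ?_
      · have := card_le_of_le_of_le le_rfl hR
        omega
      · obtain ⟨A₁, hA₁, b, hb⟩ := (stepChain_of_isoOn hK hE hf).exists_stepVia_lt hE hPlt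
        obtain ⟨k, hk, hkb⟩ := hb.exists_extension
        have hkA : (pairSystem K D).IsoOn A A₁ k := (hb.isoOn hKF).congr hkb
        obtain ⟨i, hi, hiA, -, hki⟩ := (hk.isoOn hKF).symm_pair hkA hf.cod_le
        refine hmin A₁ hA₁ fun c hc => ?_
        have h1 := hA (hi.map_centralizerIn hiA hkA.cod_le hc.1 hc)
        rw [← hki c hc.1]
        exact hkA.mem h1

end PairSystem

/-! ### Strongly embedded subgroups and extension of morphisms above `E`. -/

theorem dvd_card_of_pow_eq_one {H : Type*} [Group H] [Finite H] {p k : ℕ} [Fact p.Prime]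
    {M : Subgroup H} {x : H} (hxM : x ∈ M) (hx : x ≠ 1) (hk : x ^ p ^ k = 1) :
    p ∣ Nat.card M := by
  obtain ⟨j, -, hj⟩ := (Nat.dvd_prime_pow (Fact.out : p.Prime)).1 (orderOf_dvd_of_pow_eq_one hk)
  have hj0 : j ≠ 0 := by
    rintro rfl
    rw [pow_zero, orderOf_eq_one_iff] at hj
    exact hx hj
  exact ((dvd_pow_self p hj0).trans hj.symm.dvd).trans (Subgroup.orderOf_dvd_natCard M hxM)

namespace FusionSystem

variable {G : Type*} [Group G] {S : Subgroup G} {F : FusionSystem S} {p : ℕ}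
  {E P Q R R₁ : Subgroup G} {f : G → G}

theorem Receptive.exists_extension_le (h : F.Receptive Q) (hf : F.IsoOn P Q f) :
    ∃ X f', F.MorOn X f' ∧ P ≤ X ∧ (∀ x ∈ P, f' x = f x) ∧
      ∀ g ∈ S, g ∈ Subgroup.normalizer (P : Set G) →
        (∃ t ∈ S, ∀ x ∈ P, f (g * x * g⁻¹) = t * f x * t⁻¹) → g ∈ X := by
  obtain ⟨X, f', hX, hf', h⟩ := h P f hf
  exact ⟨X, f', hX, fun x hx => h x (hf.dom_le hx) (Subgroup.le_normalizer hx)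
    ⟨f x, hf.cod_le (hf.mem hx), fun y hy => hf.map_conj hx hy⟩, hf', h⟩

theorem Receptive.of_isoOn {χ : G → G} (h : F.Receptive R₁) (hχ : F.IsoOn S S χ)
    (hχR : F.IsoOn R R₁ χ) : F.Receptive R := by
  intro P f hf
  obtain ⟨X, f', ⟨V, hX⟩, hf', hc⟩ := h P _ (hχR.comp hf)
  obtain ⟨i, hi, hiχ, -⟩ := hχ.symm
  obtain ⟨W, -, hW⟩ := hi.restrict hX.cod_le
  refine ⟨X, i ∘ f', ⟨W, hW.comp hX⟩, fun x hx => ?_, fun g hg hgP ⟨t, ht, h⟩ => ?_⟩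
  · rw [Function.comp_apply, hf' x hx, Function.comp_apply, hiχ _ (hf.cod_le (hf.mem hx))]
  · refine hc g hg hgP ⟨χ t, hχ.mem ht, fun x hx => ?_⟩
    rw [Function.comp_apply, h x hx, hχ.map_conj ht (hf.cod_le (hf.mem hx)), Function.comp_apply]

theorem Automized.of_isoOn {χ : G → G} {hR₁ : R₁ ≤ S} (h : F.Automized p hR₁)
    (hχ : F.IsoOn S S χ) (hχR : F.IsoOn R R₁ χ) (hR : R ≤ S) : F.Automized p hR := by
  obtain ⟨α, hα, hαχ⟩ := id hχR
  have hα' := (F.iso_mem_of_comp_mem le_rfl α hα).2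
  have h1 : (F.autF hR).map (MulAut.congr α).toMonoidHom = F.autF hR₁ := by
    ext γ
    constructor
    · rintro ⟨β, hβ, rfl⟩
      exact F.comp_mem hα (F.comp_mem hβ hα')
    · intro hγ
      exact ⟨(MulAut.congr α).symm γ, F.comp_mem hα' (F.comp_mem hγ hα),
        (MulAut.congr α).apply_symm_apply γ⟩
  have h2 : (autConj S R).map (MulAut.congr α).toMonoidHom ≤ autConj S R₁ := by
    rintro _ ⟨β, ⟨t, ht, hβ⟩, rfl⟩
    refine ⟨χ t, hχ.mem ht, fun y => ?_⟩
    obtain ⟨x, rfl⟩ := α.surjective y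
    have : (MulAut.congr α).toMonoidHom β (α x) = α (β x) := by
      simp [MulAut.congr]
    rw [this, hαχ, hαχ, hβ, hχ.map_conj ht (hR x.2)]
  have h3 : autConj S R₁ ≤ (autConj S R).map (MulAut.congr α).toMonoidHom := by
    rintro γ ⟨t, ht, hγ⟩
    obtain ⟨i, hi, hiχ, hχi⟩ := hχ.symm
    refine ⟨(MulAut.congr α).symm γ, ⟨i t, hi.mem ht, fun x => ?_⟩,
      (MulAut.congr α).apply_symm_apply γ⟩
    have h4 : (((MulAut.congr α).symm γ) x : G) = i (γ (α x)) := by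
      have : α (((MulAut.congr α).symm γ) x) = γ (α x) := by simp [MulAut.congr]
      rw [← this, hαχ, hiχ _ (hR (Subtype.prop _))]
    rw [h4, hγ, hi.map_conj ht (hR₁ (α x).2), hαχ, hiχ _ (hR x.2)]
  rw [Automized, ← Subgroup.relIndex_map_map_of_injective
    (f := (MulAut.congr α).toMonoidHom) _ _ (MulAut.congr α).injective, h1, le_antisymm h2 h3]
  exact h

theorem goodPair_self (hR : R ≤ S) (ha : F.Automized p hR) (hr : F.Receptive R) :
    F.GoodPair p hR R := by
  refine ⟨le_rfl, hr, ?_⟩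
  have : autStabilizer R R = ⊤ := by
    rw [eq_top_iff]
    exact fun α _ x => ⟨fun _ => x.2, fun _ => (α x).2⟩
  rw [this, inf_top_eq]
  exact ha

theorem isPGroup_innerAut (hS : IsPGroup p S) (hR : R ≤ S) : IsPGroup p (innerAut R) := by
  rw [innerAut, MonoidHom.range_eq_map]
  exact ((hS.to_le hR).to_subgroup ⊤).map _

/-- `Q` contains a conjugate `E'` of `E`, and `C_S(Q) ≤ C_S(E') ≤ E'`. -/
theorem centralizerIn_le_of_isCentric (hE : F.IsCentric E) (hER : E ≤ R) (hf : F.IsoOn R Q f) :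
    centralizerIn S Q ≤ Q := by
  obtain ⟨E', hE', hfE⟩ := hf.restrict hER
  have h : centralizerIn S E' = centralizerIn E' E' := hE E' hfE.isConjugate
  have h1 : centralizerIn S Q ≤ centralizerIn S E' :=
    le_inf inf_le_left (inf_le_right.trans (Subgroup.centralizer_le hE'))
  rw [h] at h1
  exact (h1.trans inf_le_left).trans hE'

theorem isCentricIn_of_centralizerIn_le (hQ : Q ≤ S) (h : centralizerIn S Q ≤ Q) :
    IsCentricIn S Q :=
  le_antisymm (le_inf h inf_le_right) (inf_le_inf_right _ hQ)

variable [Fact p.Prime] [Finite S]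

/-- If morphisms on `N_S(R)` extend to automorphisms of `S`, then `R` is fully automized and
receptive in case it is conjugate to such a subgroup. -/
theorem automized_and_receptive_of_extends (hS : IsPGroup p S) (hR : R ≤ S)
    (h : F.SaturatedAt p R) (hext : ∀ f, F.MorOn (normalizerIn S R) f →
      ∃ f', F.IsoOn S S f' ∧ ∀ x ∈ normalizerIn S R, f' x = f x) :
    F.Automized p hR ∧ F.Receptive R := by
  obtain ⟨R₁, hR₁, g, hg, ha, hr⟩ := h
  obtain ⟨X, χ, hX, -, hle, hχ, -⟩ :=
    (goodPair_self hR₁ ha hr).exists_extension_normalizer hS hg hg le_rfl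
  rw [inf_idem] at hle
  obtain ⟨χ', hχ', he⟩ := hext χ (hX.restrict hle)
  have hχR := hχ.congr fun x hx => he x (le_normalizerIn hR hx)
  exact ⟨ha.of_isoOn hχ' hχR hR, hr.of_isoOn hχ' hχR⟩

/-- `Aut_S(R)` is also Sylow in the intermediate group `M`, so the conjugating element can be found
in `M`. -/
theorem exists_conj_mem_autConj (hS : IsPGroup p S) {hR : R ≤ S} (ha : F.Automized p hR)
    {M : Subgroup (MulAut R)} (hM : autConj S R ≤ M) (hMF : M ≤ F.autF hR) {x : MulAut R}
    (hx : x ∈ M) {k : ℕ} (hk : x ^ p ^ k = 1) : ∃ m ∈ M, m * x * m⁻¹ ∈ autConj S R := by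
  have : Finite R := Finite.of_injective _ (Subgroup.inclusion_injective hR)
  obtain ⟨m, hm, h⟩ := exists_conj_le_of_le_mul (N := M) (Y := Subgroup.zpowers x) hM
    (isPGroup_autConj hS) (fun h => ha (h.trans ⟨_, (Subgroup.relIndex_mul_relIndex _ _ _ hM
      hMF).symm⟩)) le_rfl (fun a ha b hb => M.mul_mem (M.mul_mem ha hb) (M.inv_mem ha))
    (by
      rintro ⟨_, j, rfl⟩
      refine ⟨k, Subtype.ext ?_⟩
      change (x ^ j) ^ p ^ k = 1
      rw [← zpow_natCast, ← zpow_mul, mul_comm, zpow_mul, zpow_natCast, hk, one_zpow]) (by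
      intro y hy
      have hyM : y ∈ M := (Subgroup.zpowers_le.2 hx) hy
      exact ⟨y⁻¹, M.inv_mem hyM, by rw [inv_mul_cancel]; exact Subgroup.one_mem _⟩)
  exact ⟨m, hm, h x (Subgroup.mem_zpowers x)⟩

/-- The subgroup consists of the classes of automorphisms that extend to `S`. If it shared an
element of order `p` with its conjugate by `γ`, then, up to factors that extend, `γ⁻¹` would
conjugate a noninner element of `Aut_S(R)` into `Aut_S(R)`. By receptivity it would extend beyond
`R`, hence to `S`. -/
theorem exists_isStronglyEmbedded (hS : IsPGroup p S) (hR : R < S) (hc : centralizerIn S R ≤ R)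
    (ha : F.Automized p hR.le) (hr : F.Receptive R)
    (hext : ∀ X f, R < X → F.MorOn X f → ∃ f', F.IsoOn S S f' ∧ ∀ x ∈ X, f' x = f x)
    (hne : ∃ f, F.IsoOn R R f ∧ ¬ ∃ f', F.IsoOn S S f' ∧ ∀ x ∈ R, f' x = f x) :
    ∃ M : Subgroup (F.outF hR.le), IsStronglyEmbedded p M := by
  have hfinR : Finite R := Finite.of_injective _ (Subgroup.inclusion_injective hR.le)
  let M₀ : Subgroup (MulAut R) := inducedAut hR.le (F.autF le_rfl)
  have hM₀F : M₀ ≤ F.autF hR.le := by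
    rintro β ⟨α, hα, h⟩
    exact mem_autF_of_restrict hR.le hR.le hα h
  have hM₀ : ∀ β : MulAut R, (∃ f', F.IsoOn S S f' ∧ ∀ x : R, f' x = β x) → β ∈ M₀ := by
    rintro β ⟨f', hf', h⟩
    obtain ⟨α, hα, hαf⟩ := exists_mem_autF hf'
    exact ⟨α, hα, fun x => by rw [hαf, Subgroup.coe_inclusion, h]⟩
  have hcM₀ : autConj S R ≤ M₀ := by
    rintro β ⟨t, ht, h⟩
    refine hM₀ β ⟨fun x => t * x * t⁻¹, (isoOn_conj le_rfl ht).restrict_of_iff le_rfl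
      (fun x hx => S.mul_mem (S.mul_mem ht hx) (S.inv_mem ht)) fun y hy =>
        ⟨t⁻¹ * y * t, S.mul_mem (S.mul_mem (S.inv_mem ht) hy) ht, by group⟩, fun x => (h x).symm⟩
  have hinn : innerAut R ≤ autConj S R := by
    rintro _ ⟨r, rfl⟩
    exact ⟨r, hR.le r.2, fun x => rfl⟩
  let N := (innerAut R).subgroupOf (F.autF hR.le)
  let M : Subgroup (F.outF hR.le) := (M₀.subgroupOf (F.autF hR.le)).map (QuotientGroup.mk' N)
  have hmem : ∀ a : F.autF hR.le, (QuotientGroup.mk' N a) ∈ M ↔ (a : MulAut R) ∈ M₀ := by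
    intro a
    constructor
    · rintro ⟨b, hb, hab⟩
      obtain ⟨n, hn, rfl⟩ := (QuotientGroup.mk'_eq_mk' N).1 hab
      exact M₀.mul_mem hb (hcM₀ (hinn hn))
    · exact fun ha => ⟨a, ha, rfl⟩
  have hone : ∀ a : F.autF hR.le, QuotientGroup.mk' N a = 1 ↔ (a : MulAut R) ∈ innerAut R := by
    intro a
    rw [QuotientGroup.mk'_apply, QuotientGroup.eq_one_iff]
    exact Subgroup.mem_subgroupOf
  have hpinn := isPGroup_innerAut hS hR.le
  have hnot : ∀ t ∈ S, t ∉ R → ∀ β : MulAut R, (∀ x : R, (β x : G) = t * x * t⁻¹) →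
      β ∉ innerAut R := by
    rintro t ht htR _ h ⟨r, rfl⟩
    refine htR ?_
    have h1 : (r : G)⁻¹ * t ∈ centralizerIn S R := by
      refine ⟨S.mul_mem (S.inv_mem (hR.le r.2)) ht, Subgroup.mem_centralizer_iff.2 fun y hy => ?_⟩
      have h2 : (r : G) * y * (r : G)⁻¹ = t * y * t⁻¹ := h ⟨y, hy⟩
      calc y * ((r : G)⁻¹ * t) = (r : G)⁻¹ * ((r : G) * y * (r : G)⁻¹) * t := by group
        _ = (r : G)⁻¹ * (t * y * t⁻¹) * t := by rw [h2]
        _ = (r : G)⁻¹ * t * y := by group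
    have := R.mul_mem r.2 (hc h1)
    rwa [mul_inv_cancel_left] at this
  refine ⟨M, fun htop => ?_, ?_, ?_⟩
  · obtain ⟨f, hf, hnf⟩ := hne
    obtain ⟨β, hβ, hβf⟩ := exists_mem_autF hf
    have h1 : QuotientGroup.mk' N ⟨β, hβ⟩ ∈ M := htop ▸ Subgroup.mem_top _
    obtain ⟨α, hα, h⟩ := (hmem _).1 h1
    refine hnf ⟨_, mem_autF_iff.1 hα, fun x hx => ?_⟩
    exact (extendFun_apply (fun x => (α x : G)) (Subgroup.inclusion hR.le ⟨x, hx⟩)).trans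
      ((h ⟨x, hx⟩).trans (hβf ⟨x, hx⟩))
  · obtain ⟨t, ht, htn, htR⟩ := exists_mem_normalizerIn_notMem hS le_rfl hR
    have htc : R.normalizerMonoidHom ⟨t, htn.2⟩ ∈ autConj S R := ⟨t, ht, fun x => rfl⟩
    let a : F.autF hR.le := ⟨_, autConj_le_autF hR.le htc⟩
    obtain ⟨k, hk⟩ := isPGroup_autConj hS ⟨_, htc⟩
    refine dvd_card_of_pow_eq_one ((hmem a).2 (hcM₀ htc))
      (fun h => hnot t ht htR _ (fun x => rfl) ((hone a).1 h)) (k := k) ?_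
    rw [← map_pow, hone]
    have : (a : MulAut R) ^ p ^ k = 1 := congrArg Subtype.val hk
    rw [Subgroup.coe_pow, this]
    exact Subgroup.one_mem _
  · intro g hg hdvd
    obtain ⟨⟨y, hyMg⟩, hy⟩ := exists_prime_orderOf_dvd_card' p hdvd
    rw [Subgroup.orderOf_mk] at hy
    obtain ⟨hyM, hyg⟩ := hyMg
    obtain ⟨x, rfl⟩ := QuotientGroup.mk'_surjective N y
    obtain ⟨γ, rfl⟩ := QuotientGroup.mk'_surjective N g
    obtain ⟨z, hz, hzx⟩ := hyg
    have hzx' : z = QuotientGroup.mk' N (γ⁻¹ * x * γ) := by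
      have h1 : QuotientGroup.mk' N γ * z * (QuotientGroup.mk' N γ)⁻¹ = QuotientGroup.mk' N x := hzx
      rw [map_mul, map_mul, map_inv, ← h1]
      group
    rw [hzx', SetLike.mem_coe, hmem] at hz
    replace hyM := (hmem x).1 hyM
    rw [hmem] at hg
    have hxinn : (x : MulAut R) ∉ innerAut R := fun h => by
      rw [(hone x).2 h, orderOf_one] at hy
      exact (Fact.out : p.Prime).one_lt.ne hy
    -- `x` has order `p` only modulo `Inn(R)`, but `Inn(R)` is a `p`-group.
    obtain ⟨k, hk⟩ : ∃ k, (x : MulAut R) ^ p ^ k = 1 := by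
      have h1 : (QuotientGroup.mk' N x) ^ p = 1 := by rw [← hy, pow_orderOf_eq_one]
      rw [← map_pow, hone] at h1
      obtain ⟨k, hk⟩ := hpinn ⟨_, h1⟩
      refine ⟨k + 1, ?_⟩
      have h2 := congrArg Subtype.val hk
      rw [pow_succ', pow_mul]
      exact h2
    have hk' : ((γ⁻¹ * x * γ : F.autF hR.le) : MulAut R) ^ p ^ k = 1 := by
      have h1 : ((γ⁻¹ * x * γ : F.autF hR.le) : MulAut R) =
          (γ : MulAut R)⁻¹ * x * ((γ : MulAut R)⁻¹)⁻¹ := by simp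
      rw [h1, conj_pow, hk]
      group
    obtain ⟨m, hm, t, ht, hmt⟩ := exists_conj_mem_autConj hS ha hcM₀ hM₀F hyM hk
    obtain ⟨m', hm', s, hs, hms⟩ := exists_conj_mem_autConj hS ha hcM₀ hM₀F hz hk'
    have htR : t ∉ R := fun h => hxinn (by
      have h1 : m * x * m⁻¹ ∈ innerAut R := ⟨⟨t, h⟩, by
        ext z
        rw [hmt]
        rfl⟩
      have h2 := (innerAut_normal R).conj_mem _ h1 m⁻¹
      have h3 : m⁻¹ * (m * x * m⁻¹) * m⁻¹⁻¹ = x := by group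
      rwa [h3] at h2)
    -- Chosen to conjugate `c_t = m x m⁻¹` to `c_s = m' (γ⁻¹ x γ) m'⁻¹`, which puts `t` in the
    -- domain of an extension of `β`.
    let β : MulAut R := m' * (γ : MulAut R)⁻¹ * m⁻¹
    have hβF : β ∈ F.autF hR.le := Subgroup.mul_mem _ (Subgroup.mul_mem _ (hM₀F hm')
      (Subgroup.inv_mem _ γ.2)) (Subgroup.inv_mem _ (hM₀F hm))
    obtain ⟨X, f', hX, hRX, hf', hXc⟩ := hr.exists_extension_le (mem_autF_iff.1 hβF)
    have htX : t ∈ X := by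
      refine hXc t ht (mem_normalizer_of_conj hmt) ⟨s, hs, fun z hz => ?_⟩
      have h1 : β * (m * x * m⁻¹) =
          (m' * ((γ⁻¹ * x * γ : F.autF hR.le) : MulAut R) * m'⁻¹) * β := by
        simp only [β, Subgroup.coe_mul, Subgroup.coe_inv]
        group
      have hz' := (Subgroup.mem_normalizer_iff.1 (mem_normalizer_of_conj hmt) z).1 hz
      have h2 : (m * x * m⁻¹) ⟨z, hz⟩ = ⟨t * z * t⁻¹, hz'⟩ := Subtype.ext (hmt _)
      calc extendFun (fun x => (β x : G)) (t * z * t⁻¹) = β ⟨_, hz'⟩ :=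
            extendFun_apply (fun x => (β x : G)) ⟨_, hz'⟩
        _ = (β * (m * x * m⁻¹)) ⟨z, hz⟩ := by rw [← h2]; rfl
        _ = s * β ⟨z, hz⟩ * s⁻¹ := by rw [h1]; exact hms (β ⟨z, hz⟩)
        _ = s * extendFun (fun x => (β x : G)) z * s⁻¹ := by
            rw [extendFun_apply (P := R) _ ⟨z, hz⟩]
    obtain ⟨f'', hf'', he⟩ := hext X f' (lt_of_le_of_ne hRX fun h => htR (h ▸ htX)) hX
    have hβM : β ∈ M₀ := hM₀ β ⟨f'', hf'', fun z => by
      rw [he _ (hRX z.2), hf' _ z.2, extendFun_apply]⟩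
    refine hg ?_
    have h1 := M₀.mul_mem (M₀.mul_mem (M₀.inv_mem hm) (M₀.inv_mem hβM)) hm'
    have h2 : m⁻¹ * β⁻¹ * m' = γ := by
      simp only [β]
      group
    rwa [h2] at h1

/-- If a centric subgroup `E` is not properly contained in any essential subgroup, then morphisms on
subgroups properly containing `E` extend to automorphisms of `S`. -/
theorem exists_extension_of_lt (hS : IsPGroup p S) (hF : F.IsSaturated p) (hE : F.IsCentric E)
    (hmax : ∀ E', F.IsEssential p E' → E ≤ E' → E' = E) (hER : E < R) (hf : F.MorOn R f) :
    ∃ f', F.IsoOn S S f' ∧ ∀ x ∈ R, f' x = f x := by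
  induction hm : Nat.card S - Nat.card R using Nat.strong_induction_on generalizing R f with
  | _ m ih =>
  obtain ⟨R', hf⟩ := hf
  have hR := hf.dom_le
  have hRc := card_le_of_le_of_le le_rfl hR
  rcases hR.eq_or_lt with rfl | hlt
  · obtain rfl : R' = R := eq_of_le_of_card_le le_rfl hf.cod_le hf.card_eq.le
    exact ⟨f, hf, fun _ _ => rfl⟩
  have hext : ∀ X f, R < X → F.MorOn X f → ∃ f', F.IsoOn S S f' ∧ ∀ x ∈ X, f' x = f x := by
    intro X f hRX hX
    obtain ⟨V, hV⟩ := id hX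
    have h1 := card_lt_of_lt_of_le hV.dom_le hRX
    have h2 := card_le_of_le_of_le le_rfl hV.dom_le
    exact ih _ (by omega) (hER.trans hRX) hX rfl
  have hRN : ∀ P < S, P < normalizerIn S P := fun P hP => by
    obtain ⟨t, ht, htn, htR⟩ := exists_mem_normalizerIn_notMem hS le_rfl hP
    exact lt_of_le_of_ne (le_normalizerIn hP.le) fun h => htR (h ▸ htn)
  obtain ⟨ha, hr⟩ := automized_and_receptive_of_extends hS hR ((isSaturated_iff hS).1 hF R hR)
    fun f hf => hext _ f (hRN R hlt) hf
  have hgood := goodPair_self hR ha hr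
  have haut : ∀ σ, F.IsoOn R R σ → ∃ f', F.IsoOn S S f' ∧ ∀ x ∈ R, f' x = σ x := by
    by_contra! hne
    obtain ⟨σ, hσ, hne⟩ := hne
    refine hER.ne' (hmax R ⟨hlt, fun Q hQ => ?_, fun Q hQ => ?_, ?_⟩ hER.le)
    · obtain ⟨g, hg⟩ := isConjugate_iff.1 hQ
      exact isCentricIn_of_centralizerIn_le hg.cod_le (centralizerIn_le_of_isCentric hE hER.le hg)
    · obtain ⟨g, hg⟩ := isConjugate_iff.1 hQ
      obtain ⟨i, hi, -, -⟩ := hg.symm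
      obtain ⟨a, M, haN, haQ⟩ := hgood.exists_extension_inf hS hi hi le_rfl
      rw [inf_idem] at haN
      exact NormalizerArrow.card_le ⟨a, M, haN, haQ⟩
    · refine exists_isStronglyEmbedded hS hlt
        (centralizerIn_le_of_isCentric hE hER.le (IsoOn.refl hR)) ha hr hext ⟨σ, hσ, ?_⟩
      rintro ⟨f', hf', h⟩
      obtain ⟨x, hx, hx'⟩ := hne f' hf'
      exact hx' (h x hx)
  have hR' : R' < S := lt_of_le_of_ne hf.cod_le fun h => by
    have h1 := card_lt_of_lt_of_le le_rfl hlt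
    rw [hf.card_eq, h] at h1
    exact lt_irrefl _ h1
  obtain ⟨i, hi, -, -⟩ := hf.symm
  -- Now `f = ψ⁻¹ ∘ (ψ ∘ f)`. The right factor is an automorphism of `R`, and `ψ⁻¹` is defined on a
  -- group larger than `R`, so both extend to `S`.
  obtain ⟨ψ, M, hψ, hψR⟩ := hgood.exists_extension_inf hS hi hi le_rfl
  rw [inf_idem] at hψ
  obtain ⟨j, hj, hjR, hjψ, -⟩ := hψ.symm_pair hψR (hRN R' hR').le
  have hRM : R < M := by
    refine lt_of_le_of_ne (fun y hy => ?_) fun h => ?_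
    · obtain ⟨x, hx, rfl⟩ := hψR.surj hy
      exact hψ.mem ((hRN R' hR').le hx)
    · have h1 : Nat.card R' < Nat.card (normalizerIn S R') :=
        card_lt_of_lt_of_le inf_le_left (hRN R' hR')
      rw [hψ.card_eq, hψR.card_eq, h] at h1
      exact lt_irrefl _ h1
  obtain ⟨b, hb, hbj⟩ := hext M j hRM hj.morOn
  obtain ⟨c, hc, hcσ⟩ := haut _ (hψR.comp hf)
  refine ⟨_, hb.comp hc, fun x hx => ?_⟩
  rw [Function.comp_apply, hcσ x hx, Function.comp_apply, hbj _ (hRM.le (hψR.mem (hf.mem hx))),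
    hjψ _ ((hRN R' hR').le (hf.mem hx))]

end FusionSystem

/-! ### Automorphisms on the normalizer tower. -/

section NormalizerTower

variable {G : Type*} [Group G] {S E Q T : Subgroup G}

theorem autStabilizer_le_autStabilizer_normalizerIn (hQ : Q ≤ S) :
    autStabilizer S Q ≤ autStabilizer S (normalizerIn S Q) := by
  have key : ∀ α ∈ autStabilizer S Q, ∀ x : S, (x : G) ∈ normalizerIn S Q →
      ∀ y ∈ Q, (α x : G) * y * (α x : G)⁻¹ ∈ Q := by
    intro α hα x hx y hy
    have hz : ((α⁻¹ ⟨y, hQ hy⟩ : S) : G) ∈ Q := ((autStabilizer S Q).inv_mem hα ⟨y, hQ hy⟩).2 hy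
    have h1 := (hα (x * α⁻¹ ⟨y, hQ hy⟩ * x⁻¹)).2 ((Subgroup.mem_normalizer_iff.1 hx.2 _).1 hz)
    rw [map_mul, map_mul, map_inv, MulAut.apply_inv_self] at h1
    exact h1
  have key' : ∀ α ∈ autStabilizer S Q, ∀ x : S, (x : G) ∈ normalizerIn S Q →
      (α x : G) ∈ normalizerIn S Q := by
    intro α hα x hx
    refine ⟨(α x).2, Subgroup.mem_normalizer_iff.2 fun y => ⟨key α hα x hx y, fun hy => ?_⟩⟩
    have h1 := key α hα x⁻¹ (Subgroup.inv_mem _ hx) _ hy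
    rw [map_inv] at h1
    simpa [mul_assoc] using h1
  intro α hα x
  refine ⟨fun hx => ?_, key' α hα x⟩
  have := key' α⁻¹ ((autStabilizer S Q).inv_mem hα) _ hx
  rwa [MulAut.inv_apply_self] at this

theorem autStabilizer_le_autStabilizer_normalizerTower (hE : E ≤ S) (i : ℕ) :
    autStabilizer S E ≤ autStabilizer S (normalizerTower S E i) := by
  induction i with
  | zero => exact le_rfl
  | succ i ih =>
    exact ih.trans (autStabilizer_le_autStabilizer_normalizerIn (normalizerTower_le hE i))

theorem normalizerTower_mono (hE : E ≤ S) : Monotone (normalizerTower S E) :=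
  monotone_nat_of_le_succ fun i => le_normalizerIn (normalizerTower_le hE i)

theorem inducedAut_eq_map {C : Subgroup (MulAut S)} (hT : T ≤ S) (hC : C ≤ autStabilizer S T) :
    inducedAut hT C = (C.subgroupOf (autStabilizer S T)).map (restrictAut hT) := by
  ext β
  constructor
  · rintro ⟨α, hα, h⟩
    exact ⟨⟨α, hC hα⟩, hα, MulEquiv.ext fun x => Subtype.ext (h x)⟩
  · rintro ⟨α, hα, rfl⟩
    exact ⟨α, hα, fun x => rfl⟩

theorem card_inducedAut_dvd {C : Subgroup (MulAut S)} (hT : T ≤ S) (hC : C ≤ autStabilizer S T) :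
    Nat.card (inducedAut hT C) ∣ Nat.card C := by
  rw [inducedAut_eq_map hT hC]
  refine (Subgroup.card_map_dvd _ _).trans ?_
  rw [Nat.card_congr (Subgroup.subgroupOfEquivOfLe hC).toEquiv]

theorem autConj_self : autConj S S = innerAut S := by
  ext α
  constructor
  · rintro ⟨t, ht, h⟩
    exact ⟨⟨t, ht⟩, MulEquiv.ext fun x => Subtype.ext (h x).symm⟩
  · rintro ⟨t, rfl⟩
    exact ⟨t, t.2, fun x => rfl⟩

theorem autConj_eq_of_normalizerIn_le (hTS : T ≤ S) (hN : normalizerIn S E ≤ T) :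
    autConj T E = autConj S E :=
  le_antisymm (fun _ ⟨t, ht, h⟩ => ⟨t, hTS ht, h⟩) fun _ ⟨t, ht, h⟩ =>
    ⟨t, hN ⟨ht, FusionSystem.mem_normalizer_of_conj h⟩, h⟩

end NormalizerTower

/-! ### The complement `C` and the proof of the theorem. -/

namespace FusionSystem

variable {G : Type*} [Group G] {S : Subgroup G} {F : FusionSystem S} {p : ℕ} {E T : Subgroup G}

theorem inducedAut_le_autF (hT : T ≤ S) {C : Subgroup (MulAut S)} (hC : C ≤ F.autF le_rfl) :
    inducedAut hT C ≤ inducedAut hT (F.autF le_rfl) := fun _ ⟨α, hα, h⟩ => ⟨α, hC hα, h⟩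

theorem innerAut_le_inducedAut_autF (hT : T ≤ S) :
    innerAut T ≤ inducedAut hT (F.autF le_rfl) := by
  rintro _ ⟨t, rfl⟩
  exact ⟨MulAut.conj (Subgroup.inclusion hT t), autConj_le_autF le_rfl
    ⟨t, hT t.2, fun x => rfl⟩, fun x => rfl⟩

/-- Write the automorphism of `S` as an element of `N_{Inn(S)}(E)` times one of `C`. The inner part
is conjugation by an element of `N_S(E) ≤ T`, so both parts restrict to `T`. -/
theorem stepVia_of_mem_complement {A C : Subgroup (MulAut S)} {f : G → G} (hES : E ≤ S)
    (hA : A = F.autF le_rfl ⊓ autStabilizer S E)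
    (hC : Subgroup.IsComplement' ((innerAut S ⊓ autStabilizer S E).subgroupOf A)
      (C.subgroupOf A)) (hT : T ≤ S) (hCT : C ≤ autStabilizer S T) (hN : normalizerIn S E ≤ T)
    (hf : F.IsoOn S S f) (hfE : F.IsoOn E E f) :
    StepVia (innerAut T ⊔ inducedAut hT C) E E f := by
  obtain ⟨a, ha, haf⟩ := exists_mem_autF hf
  have haA : a ∈ A := by
    rw [hA]
    refine ⟨ha, fun x => ?_⟩
    rw [haf]
    exact hf.apply_mem_iff hfE hES x.2
  obtain ⟨⟨⟨n, hn⟩, ⟨c, hc⟩⟩, hnc⟩ := hC.2 ⟨a, haA⟩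
  obtain ⟨⟨s, hs⟩, hnE⟩ := Subgroup.mem_subgroupOf.1 hn
  have hsE : (s : G) ∈ Subgroup.normalizer (E : Set G) := by
    have key : ∀ x : S, (s : G) * x * (s : G)⁻¹ ∈ E ↔ (x : G) ∈ E := fun x => by
      rw [← hnE x, ← hs]
      rfl
    refine Subgroup.mem_normalizer_iff.2 fun y => ⟨fun hy => (key ⟨y, hES hy⟩).2 hy, fun hy => ?_⟩
    have hyS : y ∈ S := by
      have h1 := S.mul_mem (S.mul_mem (S.inv_mem s.2) (hES hy)) s.2
      have h2 : (s : G)⁻¹ * (s * y * (s : G)⁻¹) * s = y := by group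
      rwa [h2] at h1
    exact (key ⟨y, hyS⟩).1 hy
  have hsT : (s : G) ∈ T := hN ⟨s.2, hsE⟩
  have hac : ∀ x : S, (a x : G) = s * (c : MulAut S) x * (s : G)⁻¹ := by
    intro x
    have h1 : (n : MulAut S) * c = a := congrArg Subtype.val hnc
    rw [← h1, ← hs]
    rfl
  refine ⟨(le_normalizerIn hES).trans hN, ⟨MulAut.conj ⟨s, hsT⟩ *
    restrictAut hT ⟨c, hCT (Subgroup.mem_subgroupOf.1 hc)⟩, Subgroup.mul_mem_sup ⟨_, rfl⟩
      ⟨c, Subgroup.mem_subgroupOf.1 hc, fun x => rfl⟩, fun x _ => ?_⟩, fun y => ⟨fun hy => ?_, ?_⟩⟩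
  · exact (haf (Subgroup.inclusion hT x)).symm.trans (hac _)
  · exact hfE.surj hy
  · rintro ⟨x, hx, rfl⟩
    exact hfE.mem hx

variable [Fact p.Prime] [Finite S]

theorem automized_top (hS : IsPGroup p S) (hF : F.IsSaturated p) :
    F.Automized p (le_refl S) := by
  obtain ⟨Q, hQ, f, hf, ha, -⟩ := (isSaturated_iff hS).1 hF S le_rfl
  obtain rfl : Q = S := eq_of_le_of_card_le le_rfl hQ hf.card_eq.le
  exact ha

/-- A complement to the group of inner automorphisms stabilizing `E` in the group of all
automorphisms in `F` stabilizing `E` has order prime to `p`. -/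
theorem not_dvd_card_of_isComplement' (hS : IsPGroup p S) (hF : F.IsSaturated p)
    {A C : Subgroup (MulAut S)} (hA : A = F.autF le_rfl ⊓ autStabilizer S E) (hCA : C ≤ A)
    (hC : Subgroup.IsComplement' ((innerAut S ⊓ autStabilizer S E).subgroupOf A)
      (C.subgroupOf A)) : ¬ p ∣ Nat.card C := by
  intro hp
  obtain ⟨⟨c, hc⟩, hord⟩ := exists_prime_orderOf_dvd_card' p hp
  rw [Subgroup.orderOf_mk] at hord
  have hcA := hCA hc
  have hcA' := hcA
  rw [hA] at hcA'
  -- `Inn(S)` is a normal Sylow `p`-subgroup of `Aut_F(S)`, so it contains every element of order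
  -- `p`; but `C` meets it trivially.
  obtain ⟨m, -, hm⟩ := exists_conj_mem_autConj hS (automized_top hS hF)
    (autConj_le_autF le_rfl) le_rfl hcA'.1 (k := 1) (by rw [pow_one, ← hord, pow_orderOf_eq_one])
  rw [autConj_self] at hm
  have hci : c ∈ innerAut S := by
    have h1 := (innerAut_normal S).conj_mem _ hm m⁻¹
    have h2 : m⁻¹ * (m * c * m⁻¹) * m⁻¹⁻¹ = c := by group
    rwa [h2] at h1
  have h1 : (⟨c, hcA⟩ : A) = 1 := Subgroup.disjoint_def.1 hC.disjoint
    (Subgroup.mem_subgroupOf.2 ⟨hci, hcA'.2⟩) (Subgroup.mem_subgroupOf.2 hc)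
  have h2 : c = 1 := congrArg Subtype.val h1
  rw [h2, orderOf_one] at hord
  exact (Fact.out : p.Prime).one_lt.ne hord

end FusionSystem

theorem theorem5 {G : Type*} [Group G] (p : ℕ) [Fact p.Prime]
    (S : Subgroup G) [Finite S] (hS : IsPGroup p S)
    (F : FusionSystem S) (hF : F.IsSaturated p)
    (E : Subgroup G) (hES : E ≤ S) (hE : F.IsEssential p E)
    (hmax : ∀ E' : Subgroup G, F.IsEssential p E' → E ≤ E' → E' = E)
    (A : Subgroup (MulAut S)) (hA : A = F.autF le_rfl ⊓ autStabilizer S E)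
    (C : Subgroup (MulAut S)) (hCA : C ≤ A)
    (hC : Subgroup.IsComplement' ((innerAut S ⊓ autStabilizer S E).subgroupOf A) (C.subgroupOf A))
    (hmin : ∀ P : Subgroup G, P < E → ¬ IsCentricIn (normalizerTower S E 1) P)
    (i : ℕ) (hi : 1 ≤ i) :
    C ≤ autStabilizer S (normalizerTower S E i) ∧
    (FusionSystem.generate (normalizerTower S E i)
      (autMorphisms (innerAut (normalizerTower S E i) ⊔
          inducedAut (normalizerTower_le hES i) C) ∪
        autMorphisms (F.autF hES))).IsSaturated p := by
  have hCF : C ≤ F.autF le_rfl := hCA.trans (hA.trans_le inf_le_left)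
  have hCT : C ≤ autStabilizer S (normalizerTower S E i) :=
    (hCA.trans (hA.trans_le inf_le_right)).trans
      (autStabilizer_le_autStabilizer_normalizerTower hES i)
  refine ⟨hCT, ?_⟩
  obtain ⟨hlt, hcen, -, -⟩ := hE
  have hTS := normalizerTower_le hES i
  have hNT : normalizerIn S E ≤ normalizerTower S E i := normalizerTower_mono hES hi
  have hET : E ≤ normalizerTower S E i := (le_normalizerIn hES).trans hNT
  have hEN : E < normalizerIn S E := by
    obtain ⟨t, ht, htn, htE⟩ := exists_mem_normalizerIn_notMem hS le_rfl hlt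
    exact lt_of_le_of_ne (le_normalizerIn hES) fun h => htE (h ▸ htn)
  obtain ⟨haut, hrec⟩ := FusionSystem.automized_and_receptive_of_extends hS hES
    ((FusionSystem.isSaturated_iff hS).1 hF E hES) fun f hf => FusionSystem.exists_extension_of_lt hS hF hcen hmax hEN hf
  have hfin : Finite (normalizerTower S E i) :=
    Finite.of_injective _ (Subgroup.inclusion_injective hTS)
  refine isSaturated_pairSystem (hS.to_le hTS) le_sup_left ?_ hET ?_ ?_ ?_ ?_
  -- The index of `Inn(T)` in `Inn(T) C_i` divides `|C_i|`, which divides `|C|`.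
  · rw [Subgroup.relIndex_sup_left]
    exact fun h => FusionSystem.not_dvd_card_of_isComplement' hS hF hA hCA hC
      ((h.trans (Subgroup.relIndex_dvd_card _ _)).trans (card_inducedAut_dvd hTS hCT))
  · rintro f ⟨-, ⟨k, hk, hkf⟩, hfE⟩
    obtain ⟨α, hα, hαk⟩ := (sup_le (FusionSystem.innerAut_le_inducedAut_autF hTS)
      (FusionSystem.inducedAut_le_autF hTS hCF)) hk
    have he : ∀ x ∈ E, f x = extendFun (fun x => (α x : G)) x := fun x hx => by
      rw [hkf ⟨x, hET hx⟩ hx, ← hαk, ← extendFun_apply (fun x => (α x : G))]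
      rfl
    have hfi : F.IsoOn E E f := ((FusionSystem.mem_autF_iff.1 hα).restrict_of_iff hES
      (fun x hx => he x hx ▸ (hfE _).2 ⟨x, hx, rfl⟩) fun y hy => by
        obtain ⟨x, hx, rfl⟩ := (hfE y).1 hy
        exact ⟨x, hx, (he x hx).symm⟩).congr he
    obtain ⟨δ, hδ, hδf⟩ := FusionSystem.exists_mem_autF hfi
    exact ⟨le_rfl, ⟨δ, hδ, fun x _ => (hδf x).symm⟩, hfE⟩
  · rw [autConj_eq_of_normalizerIn_le hTS hNT]
    exact haut
  -- Receptivity extends `f` to a group containing `g ∉ E`, hence properly containing `E`. From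
  -- there it extends to `S`, and the complement decomposition applies.
  · rintro f hf g hg hgE hgn ⟨t, ht, h⟩
    have hfi : F.IsoOn E E f := hf.isoOn le_rfl
    obtain ⟨X, f', hX, hEX, hf', hXc⟩ := hrec.exists_extension_le hfi
    have hgX : g ∈ X := hXc g (hTS hg) hgE ⟨t, hTS ht, h⟩
    obtain ⟨a, ha, haf⟩ := FusionSystem.exists_extension_of_lt hS hF hcen hmax
      (lt_of_le_of_ne hEX fun he => hgn (he ▸ hgX)) hX
    have haf' : ∀ x ∈ E, a x = f x := fun x hx => by rw [haf x (hEX hx), hf' x hx]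
    exact (FusionSystem.stepVia_of_mem_complement hES hA hC hTS hCT hNT ha (hfi.congr haf')).congr
      fun x hx => (haf' x hx).symm
  -- Since `S_1 ≤ S_i`, a subgroup `P` containing `C_{S_i}(P)` would be `S_1`-centric.
  · intro P hP hle
    have h1 : normalizerTower S E 1 ≤ normalizerTower S E i := normalizerTower_mono hES hi
    exact hmin P hP (FusionSystem.isCentricIn_of_centralizerIn_le (hP.le.trans hEN.le)
      ((inf_le_inf_right _ h1).trans hle))
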